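/- Let $\delta>0$, $\sigma\ge 0$, and let $\Pi$ be a real random variable with $\mathbb{E}\,\Pi^2<\infty$ and $\epsilon:=\mathbb{P}(\Pi\ne 0)\in(0,1]$. Let $\Pi^\star$ have the distribution of $\Pi$ conditional on $\Pi\neq 0$, let $W\sim\mathcal N(0,1)$ be independent of $\Pi$ and of $\Pi^\star$, let $\Phi,\phi$ be the standard normal distribution function and density, and let $\eta_\theta(x)=\operatorname{sign}(x)(|x|-\theta)_+$. For $\lambda>0$ let $(\alpha,\tau)=(\alpha(\lambda),\tau(\lambda))$, with $\alpha>0$ and $\tau>0$, be the solution of $$\tau^2=\sigma^2+\tfrac1\delta\,\mathbb{E}\big(\eta_{\alpha\tau}(\Pi+\tau W)-\Pi\big)^2,\qquad \lambda=\Big(1-\tfrac1\delta\,\mathbb{P}(|\Pi+\tau W|>\alpha\tau)\Big)\alpha\tau,$$ and define $$\mathrm{tpp}^\infty(\lambda)=\mathbb{P}(|\Pi^\star+\tau W|>\alpha\tau),\qquad \mathrm{fdp}^\infty(\lambda)=\frac{2(1-\epsilon)\Phi(-\alpha)}{2(1-\epsilon)\Phi(-\alpha)+\epsilon\,\mathrm{tpp}^\infty(\lambda)}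 .$$ For $0<\delta<1$ let $\epsilon^\star(\delta)$ be the unique $e>0$ for which the equation $$2(1-e)\big[(1+t^2)\Phi(-t)-t\phi(t)\big]+e(1+t^2)=\delta$$ has a unique positive root $t$, and put $\epsilon^\star(1):=1=\lim_{\delta\uparrow1}\epsilon^\star(\delta)$. Then: 1. $\lim_{\lambda\to\infty}\mathrm{tpp}^\infty(\lambda)=0$. 2. If $\delta>1$, then the limit $\lim_{\lambda\to0^+}(\mathrm{tpp}^\infty(\lambda),\mathrm{fdp}^\infty(\lambda))$ exists and lies on the vertical line $\mathrm{tpp}=1$. 3. If $\delta\le1$ and $\epsilon\ge\epsilon^\star(\delta)$, then the limit $\lim_{\lambda\to0^+}(\mathrm{tpp}^\infty(\lambda),\mathrm{fdp}^\infty(\lambda))$ exists and lies on the line $\frac{\epsilon}{\delta}\,\mathrm{tpp}+\mathrm{fdp}=1$. 4. If $\delta\le1$ and $\epsilon<\epsilon^\star(\delta)$, then the limit $\lim_{\lambda\to0^+}(\mathrm{tpp}^\infty(\lambda),\mathrm{fdp}^\infty(\lambda))$ exists and lies on the poly-line made of the two lines $\mathrm{tpp}=1$ and $\frac{\epsilon}{\delta}\,\mathrm{tpp}+\mathrm{fdp}=1$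 with corner at $(1,1-\frac{\epsilon}{\delta})$, that is, on $$\big\{(x,y): 0\le x\le1,\ \tfrac{\epsilon}{\delta}x+y=1\big\}\ \cup\ \big\{(1,y): 0\le y\le 1-\tfrac{\epsilon}{\delta}\big\}.$$ -/

import Mathlib

open Filter Topology MeasureTheory ProbabilityTheory

namespace Lasso

noncomputable section

/-- The law of a standard normal variable `W`. -/
abbrev stdNormal : Measure ℝ := gaussianReal 0 1

/-- The standard normal distribution function. -/
def Phi (t : ℝ) : ℝ := cdf stdNormal t

/-- The standard normal density. -/
def phi (t : ℝ) : ℝ := gaussianPDFReal 0 1 t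

/-- Soft thresholding at level `θ`: `sign(x) (|x| - θ)₊`. -/
def softThreshold (θ x : ℝ) : ℝ := Real.sign x * max (|x| - θ) 0

/-- The sparsity ratio `ε = ℙ(Π ≠ 0)` of a prior `Π` with law `μ`. -/
def sparsity (μ : Measure ℝ) : ℝ := μ.real {0}ᶜ

/-- The law of `Π⋆`, i.e. of `Π` conditionally on `Π ≠ 0`. -/
def nonzeroPart (μ : Measure ℝ) : Measure ℝ := ProbabilityTheory.cond μ {0}ᶜ

/-- `ℙ(|X + τ W| > α τ)` where `X` has law `ν` and `W` is standard normal, independent of `X`. -/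
def selectionProb (ν : Measure ℝ) (α τ : ℝ) : ℝ :=
  (ν.prod stdNormal).real {z : ℝ × ℝ | α * τ < |z.1 + τ * z.2|}

/-- `𝔼 (η_{ατ}(X + τ W) - X)²` where `X` has law `ν` and `W` is standard normal,
independent of `X`. -/
def thresholdRisk (ν : Measure ℝ) (α τ : ℝ) : ℝ :=
  ∫ z : ℝ × ℝ, (softThreshold (α * τ) (z.1 + τ * z.2) - z.1) ^ 2 ∂(ν.prod stdNormal)

/-- `p = (α, τ)`, with both entries positive, solves the state evolution equation and the
calibration equation at penalty `lam`. -/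
def IsStateSolution (δ σ : ℝ) (μ : Measure ℝ) (lam : ℝ) (p : ℝ × ℝ) : Prop :=
  0 < p.1 ∧ 0 < p.2 ∧
    p.2 ^ 2 = σ ^ 2 + 1 / δ * thresholdRisk μ p.1 p.2 ∧
    lam = (1 - 1 / δ * selectionProb μ p.1 p.2) * (p.1 * p.2)

/-- The solution `(α(lam), τ(lam))` of the state evolution and calibration equations. -/
def stateSolution (δ σ : ℝ) (μ : Measure ℝ) (lam : ℝ) : ℝ × ℝ :=
  Classical.epsilon (IsStateSolution δ σ μ lam)

/-- The limiting true positive proportion at penalty `lam`. -/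
def tppInf (δ σ : ℝ) (μ : Measure ℝ) (lam : ℝ) : ℝ :=
  selectionProb (nonzeroPart μ) (stateSolution δ σ μ lam).1 (stateSolution δ σ μ lam).2

/-- The limiting false discovery proportion at penalty `lam`. -/
def fdpInf (δ σ : ℝ) (μ : Measure ℝ) (lam : ℝ) : ℝ :=
  2 * (1 - sparsity μ) * Phi (-(stateSolution δ σ μ lam).1) /
    (2 * (1 - sparsity μ) * Phi (-(stateSolution δ σ μ lam).1) +
      sparsity μ * tppInf δ σ μ lam)

/-- The left-hand side of the equation defining the Donoho–Tanner phase transition. -/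
def dtFun (ε t : ℝ) : ℝ :=
  2 * (1 - ε) * ((1 + t ^ 2) * Phi (-t) - t * phi t) + ε * (1 + t ^ 2)

/-- `e > 0` is such that the equation `dtFun e t = δ` has a unique positive root `t`. -/
def IsPhaseTransition (δ e : ℝ) : Prop :=
  0 < e ∧ ∃! t : ℝ, 0 < t ∧ dtFun e t = δ

/-- The Donoho–Tanner phase transition point `ε⋆(δ)`. For `0 < δ < 1` it is the unique `e > 0` such
that `dtFun e t = δ` has a unique positive root `t`. At `δ = 1` it takes the value `1`, the limit
of `ε⋆(δ)` as `δ ↑ 1` (and the threshold above which there is no positive root); the values for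
`δ > 1` play no role. -/
def epsStar (δ : ℝ) : ℝ :=
  open Classical in
  if δ < 1 then Classical.epsilon (IsPhaseTransition δ) else 1

/-- The line `(ε / δ) tpp + fdp = 1` in the `(tpp, fdp)` plane. -/
def boundaryLine (ε δ : ℝ) : Set (ℝ × ℝ) := {L | ε / δ * L.1 + L.2 = 1}

/-- The poly-line that follows `(ε / δ) tpp + fdp = 1` for `0 ≤ tpp ≤ 1` up to its corner
`(1, 1 - ε / δ)`, and then the vertical line `tpp = 1` down to `fdp = 0`. -/
def boundaryPolyline (ε δ : ℝ) : Set (ℝ × ℝ) :=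
  {L | (L ∈ boundaryLine ε δ ∧ 0 ≤ L.1 ∧ L.1 ≤ 1) ∨ (L.1 = 1 ∧ 0 ≤ L.2 ∧ L.2 ≤ 1 - ε / δ)}

end

end Lasso

/-! The solutions are parametrized by the threshold `α` instead of the penalty. After rescaling by
`τ`, the state evolution equation reads `stateFun δ σ μ α τ = 1`. Its left side is strictly
decreasing in `τ`, since the risk of soft thresholding increases with the size of the signal, so
each `α` carries at most one noise level `effectiveNoise` and one penalty `penaltyAt`, both
continuous in `α` where they are defined. For a given penalty `lam > 0` the pair `(α, τ)` is unique
(`isStateSolution_unique`, from the monotonicity of the subgradients of `|·|`). Hence any solution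
found on the curve by the intermediate value theorem is the one that `stateSolution` chooses, and
limits along the curve become limits in the penalty.

As `α → ∞` the noise level stays away from zero, the penalty tends to infinity, and the selection
probability is `O(1 / α²)`. This gives the limit of the true positive proportion at infinite
penalty.

For `lam → 0⁺`, let `c` be the supremum of `0` and the thresholds that carry no positive penalty.
The penalty tends to zero as `α ↓ c`, in one of three ways (`exists_tendsto_proportions`). If the
equation is solvable at `c > 0`, the penalty vanishes there, so `2(1-ε)Φ(-c) + ε tpp = δ`: this is
the sloped line. If it is not solvable at `c > 0`, then `σ = 0` and `τ → 0`, so `tpp = 1`, `dtFun ε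
c = δ` and `2(1-ε)Φ(-c) + ε ≤ δ`: this is the vertical segment. If `c = 0`, everything is selected
in the limit, so `tpp = 1` and `δ ≥ 1`.

The phase transition bears on the second case only. For `δ < 1` and `ε ≥ ε⋆(δ)`, `dtFun ε` never
drops below `δ` on the positive axis, so it is minimal at `c` and its derivative vanishes there.
Since `dtFun ε t - (t / 2) (dtFun ε)'(t) = 2(1-ε)Φ(-t) + ε`, the inequality becomes an equality and
the limit lies on the sloped line again. -/

namespace Lasso

/-! ### Gaussian density, distribution function and truncated moments -/

lemma phi_eq (t : ℝ) : phi t = (√(2 * Real.pi))⁻¹ * Real.exp (-t ^ 2 / 2) := by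
  simp [phi, gaussianPDFReal]

lemma phi_pos (t : ℝ) : 0 < phi t := gaussianPDFReal_pos _ _ _ one_ne_zero

lemma phi_neg (t : ℝ) : phi (-t) = phi t := by simp [phi_eq]

lemma hasDerivAt_phi (t : ℝ) : HasDerivAt phi (-t * phi t) t := by
  have h : HasDerivAt (fun t : ℝ => (√(2 * Real.pi))⁻¹ * Real.exp (-t ^ 2 / 2))
      ((√(2 * Real.pi))⁻¹ * (Real.exp (-t ^ 2 / 2) * (-(2 * t) / 2))) t := by
    have h1 : HasDerivAt (fun t : ℝ => -t ^ 2 / 2) (-(2 * t) / 2) t := by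
      simpa using ((hasDerivAt_pow 2 t).neg.div_const 2)
    exact h1.exp.const_mul _
  have h2 : phi = fun t : ℝ => (√(2 * Real.pi))⁻¹ * Real.exp (-t ^ 2 / 2) := funext phi_eq
  rw [h2]
  convert h using 1
  ring

lemma continuous_phi : Continuous phi :=
  continuous_iff_continuousAt.2 fun t => (hasDerivAt_phi t).continuousAt

lemma phi_le_half (t : ℝ) : phi t ≤ 1 / 2 := by
  rw [phi_eq]
  have h1 : (2 : ℝ) ≤ √(2 * Real.pi) := by
    apply Real.le_sqrt_of_sq_le
    nlinarith [Real.pi_gt_three]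
  have h2 : (√(2 * Real.pi))⁻¹ ≤ 1 / 2 := by
    rw [inv_eq_one_div]
    exact one_div_le_one_div_of_le two_pos h1
  have h3 : Real.exp (-t ^ 2 / 2) ≤ 1 := Real.exp_le_one_iff.2 (by nlinarith [sq_nonneg t])
  exact (mul_le_mul h2 h3 (Real.exp_pos _).le (by norm_num)).trans_eq (mul_one _)

lemma phi_le_phi {s t : ℝ} (h : |s| ≤ |t|) : phi t ≤ phi s := by
  rw [phi_eq, phi_eq]
  have := sq_le_sq.2 h
  gcongr

lemma integrable_phi : Integrable phi := integrable_gaussianPDFReal 0 1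

lemma integral_stdNormal (f : ℝ → ℝ) : ∫ w, f w ∂stdNormal = ∫ w, phi w * f w := by
  rw [stdNormal, integral_gaussianReal_eq_integral_smul one_ne_zero]
  rfl

lemma integrable_stdNormal_iff (f : ℝ → ℝ) :
    Integrable f stdNormal ↔ Integrable (fun w => phi w * f w) := by
  rw [stdNormal, gaussianReal_of_var_ne_zero _ one_ne_zero]
  have : gaussianPDF 0 1 = fun w => ENNReal.ofReal (phi w) := rfl
  rw [this, integrable_withDensity_iff_integrable_smul' continuous_phi.measurable.ennreal_ofReal (by simp)]
  simp [ENNReal.toReal_ofReal (phi_pos _).le]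

lemma memLp_id_stdNormal : MemLp (fun w : ℝ => w) 2 stdNormal := memLp_id_gaussianReal 2

lemma integrable_id_stdNormal : Integrable (fun w : ℝ => w) stdNormal :=
  memLp_id_stdNormal.integrable one_le_two

lemma integrable_sq_stdNormal : Integrable (fun w : ℝ => w ^ 2) stdNormal :=
  memLp_id_stdNormal.integrable_sq

lemma integrable_quadratic_stdNormal (a b c : ℝ) :
    Integrable (fun w : ℝ => a * w ^ 2 + b * w + c) stdNormal :=
  ((integrable_sq_stdNormal.const_mul a).add (integrable_id_stdNormal.const_mul b)).add
    (integrable_const c)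

lemma Phi_eq (t : ℝ) : Phi t = ∫ w in Set.Iic t, phi w := by
  rw [Phi, cdf_eq_real, Measure.real, gaussianReal_apply_eq_integral _ one_ne_zero,
    ENNReal.toReal_ofReal]
  · rfl
  · exact integral_nonneg fun w => (phi_pos w).le

lemma Phi_sub (a b : ℝ) : Phi b - Phi a = ∫ w in a..b, phi w := by
  rw [Phi_eq, Phi_eq, intervalIntegral.integral_Iic_sub_Iic integrable_phi.integrableOn
    integrable_phi.integrableOn]

lemma hasDerivAt_Phi (t : ℝ) : HasDerivAt Phi (phi t) t := by
  have h : Phi = fun x => Phi 0 + ∫ w in (0 : ℝ)..x, phi w := by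
    ext x
    rw [← Phi_sub]; ring
  rw [h]
  exact (intervalIntegral.integral_hasDerivAt_right (continuous_phi.intervalIntegrable _ _)
    (continuous_phi.stronglyMeasurableAtFilter _ _) continuous_phi.continuousAt).const_add _

lemma continuous_Phi : Continuous Phi :=
  continuous_iff_continuousAt.2 fun t => (hasDerivAt_Phi t).continuousAt

lemma Phi_nonneg (t : ℝ) : 0 ≤ Phi t := cdf_nonneg _ _

lemma tendsto_Phi_atTop : Tendsto Phi atTop (𝓝 1) := tendsto_cdf_atTop _

lemma tendsto_Phi_atBot : Tendsto Phi atBot (𝓝 0) := tendsto_cdf_atBot _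

lemma strictMono_Phi : StrictMono Phi :=
  strictMono_of_hasDerivAt_pos hasDerivAt_Phi phi_pos

lemma Phi_pos (t : ℝ) : 0 < Phi t :=
  (Phi_nonneg (t - 1)).trans_lt (strictMono_Phi (by linarith))

lemma Phi_neg (t : ℝ) : Phi (-t) = 1 - Phi t := by
  have hd : ∀ x, HasDerivAt (fun x => Phi x + Phi (-x)) 0 x := fun x => by
    exact ((hasDerivAt_Phi x).add ((hasDerivAt_Phi (-x)).comp x (hasDerivAt_neg x))).congr_deriv
      (by rw [phi_neg]; ring)
  have hc : ∀ x, Phi x + Phi (-x) = Phi t + Phi (-t) := fun x =>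
    is_const_of_deriv_eq_zero (fun x => (hd x).differentiableAt) (fun x => (hd x).deriv) x t
  have hl : Tendsto (fun x => Phi x + Phi (-x)) atTop (𝓝 (1 + 0)) :=
    tendsto_Phi_atTop.add (tendsto_Phi_atBot.comp tendsto_neg_atTop_atBot)
  have := tendsto_nhds_unique (hl.congr hc) tendsto_const_nhds
  linarith

lemma Phi_zero : Phi 0 = 1 / 2 := by
  have := Phi_neg 0
  rw [neg_zero] at this
  linarith

lemma Phi_sub_le {a b : ℝ} (h : a ≤ b) : Phi b - Phi a ≤ (b - a) / 2 := by
  rw [Phi_sub]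
  calc ∫ w in a..b, phi w ≤ ∫ w in a..b, (1 / 2 : ℝ) :=
        intervalIntegral.integral_mono_on h (continuous_phi.intervalIntegrable _ _)
          (by simp) fun x _ => phi_le_half x
    _ = _ := by simp; ring

lemma integrable_mul_phi : Integrable (fun w => w * phi w) := by
  simpa [mul_comm] using (integrable_stdNormal_iff _).1 integrable_id_stdNormal

lemma integrable_sq_mul_phi : Integrable (fun w => w ^ 2 * phi w) := by
  simpa [mul_comm] using (integrable_stdNormal_iff _).1 integrable_sq_stdNormal

lemma hasDerivAt_mul_phi (w : ℝ) :
    HasDerivAt (fun w => w * phi w) (phi w - w ^ 2 * phi w) w := by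
  exact ((hasDerivAt_id w).mul (hasDerivAt_phi w)).congr_deriv (by simp; ring)

lemma tendsto_phi_atTop : Tendsto phi atTop (𝓝 0) := by
  refine tendsto_zero_of_hasDerivAt_of_integrableOn_Ioi (a := 0) (f' := fun w => -w * phi w)
    (fun x _ => hasDerivAt_phi x) ?_ integrable_phi.integrableOn
  simpa using integrable_mul_phi.neg.integrableOn

lemma tendsto_mul_phi_atTop : Tendsto (fun w => w * phi w) atTop (𝓝 0) :=
  tendsto_zero_of_hasDerivAt_of_integrableOn_Ioi (a := 0)
    (fun x _ => hasDerivAt_mul_phi x) (integrable_phi.sub integrable_sq_mul_phi).integrableOn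
    integrable_mul_phi.integrableOn

/-- The integrand has the antiderivative `a (Φ - w φ) - b φ + c Φ`. Risks, selection probabilities
and correlations are all integrals of functions that are quadratic on each of three intervals, so
this formula and its mirror image evaluate them. -/
lemma integral_Ioi_quadratic (a b c s : ℝ) :
    ∫ w, (Set.Ioi s).indicator (fun w : ℝ => a * w ^ 2 + b * w + c) w ∂stdNormal =
      a * (Phi (-s) + s * phi s) + b * phi s + c * Phi (-s) := by
  rw [integral_stdNormal]
  have h1 : (fun w => phi w * (Set.Ioi s).indicator (fun w : ℝ => a * w ^ 2 + b * w + c) w) =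
      (Set.Ioi s).indicator (fun w => phi w * (a * w ^ 2 + b * w + c)) := by
    ext w
    by_cases h : w ∈ Set.Ioi s <;> simp only [Set.indicator_of_mem, Set.indicator_of_notMem, h,
      not_false_eq_true, mul_zero]
  rw [h1, integral_indicator measurableSet_Ioi]
  have hd : ∀ x ∈ Set.Ici s, HasDerivAt
      (fun w => a * (Phi w - w * phi w) - b * phi w + c * Phi w)
      (phi x * (a * x ^ 2 + b * x + c)) x := fun x _ => by
    exact (((((hasDerivAt_Phi x).sub (hasDerivAt_mul_phi x)).const_mul a).sub
      ((hasDerivAt_phi x).const_mul b)).add ((hasDerivAt_Phi x).const_mul c)).congr_deriv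
      (by ring)
  have hl : Tendsto (fun w => a * (Phi w - w * phi w) - b * phi w + c * Phi w) atTop
      (𝓝 (a * (1 - 0) - b * 0 + c * 1)) :=
    (((tendsto_Phi_atTop.sub tendsto_mul_phi_atTop).const_mul a).sub
      (tendsto_phi_atTop.const_mul b)).add (tendsto_Phi_atTop.const_mul c)
  rw [integral_Ioi_of_hasDerivAt_of_tendsto' hd
    ((integrable_stdNormal_iff _).1 (integrable_quadratic_stdNormal a b c)).integrableOn hl,
    Phi_neg]
  ring

lemma integral_neg_stdNormal (f : ℝ → ℝ) :
    ∫ w, f (-w) ∂stdNormal = ∫ w, f w ∂stdNormal := by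
  rw [integral_stdNormal, integral_stdNormal, ← integral_neg_eq_self]
  simp [phi_neg]

lemma integral_Iio_quadratic (a b c s : ℝ) :
    ∫ w, (Set.Iio s).indicator (fun w : ℝ => a * w ^ 2 + b * w + c) w ∂stdNormal =
      a * (Phi s - s * phi s) - b * phi s + c * Phi s := by
  rw [← integral_neg_stdNormal]
  have h := integral_Ioi_quadratic a (-b) c (-s)
  rw [neg_neg, phi_neg] at h
  have h2 : ∀ w : ℝ, (Set.Iio s).indicator (fun w : ℝ => a * w ^ 2 + b * w + c) (-w) =
      (Set.Ioi (-s)).indicator (fun w : ℝ => a * w ^ 2 + -b * w + c) w := fun w => by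
    simp only [Set.indicator, Set.mem_Iio, Set.mem_Ioi, neg_lt]
    split_ifs <;> ring
  simp only [h2, h]
  ring

lemma integral_quadratic (a b c : ℝ) :
    ∫ w, (a * w ^ 2 + b * w + c) ∂stdNormal = a + c := by
  have h0 : ∫ w, w ∂stdNormal = (0 : ℝ) := integral_id_gaussianReal
  have h2 : ∫ w, w ^ 2 ∂stdNormal = (1 : ℝ) := by
    have := variance_fun_id_gaussianReal (μ := 0) (v := 1)
    rw [variance_of_integral_eq_zero (by fun_prop) h0] at this
    simpa using this
  have h1 : Integrable (fun w : ℝ => a * w ^ 2 + b * w) stdNormal :=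
    (integrable_sq_stdNormal.const_mul a).add (integrable_id_stdNormal.const_mul b)
  rw [integral_add h1 (integrable_const c),
    integral_add (integrable_sq_stdNormal.const_mul a) (integrable_id_stdNormal.const_mul b),
    integral_const_mul, integral_const_mul, h0, h2]
  simp

/-! ### Soft thresholding -/

lemma softThreshold_eq {θ : ℝ} (hθ : 0 ≤ θ) (x : ℝ) :
    softThreshold θ x = max (x - θ) 0 - max (-x - θ) 0 := by
  rw [softThreshold]
  rcases lt_trichotomy x 0 with h | h | h
  · rw [Real.sign_of_neg h, abs_of_neg h, max_eq_right (by linarith : x - θ ≤ 0)]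
    ring
  · subst h
    simp
  · rw [Real.sign_of_pos h, abs_of_pos h, max_eq_right (by linarith : -x - θ ≤ 0)]
    ring

/-- Homogeneity: at noise level `τ` everything depends on the signal only through `x / τ`. -/
lemma softThreshold_mul {α τ : ℝ} (hα : 0 ≤ α) (hτ : 0 < τ) (x w : ℝ) :
    softThreshold (α * τ) (x + τ * w) = τ * softThreshold α (x / τ + w) := by
  rw [softThreshold_eq (by positivity), softThreshold_eq hα, mul_sub,
    mul_max_of_nonneg _ _ hτ.le, mul_max_of_nonneg _ _ hτ.le, mul_zero]
  have h : x = τ * (x / τ) := by field_simp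
  congr 2
  · nth_rw 1 [h]; ring
  · nth_rw 1 [h]; ring

lemma continuous_softThreshold {θ : ℝ} (hθ : 0 ≤ θ) : Continuous (softThreshold θ) := by
  rw [funext (softThreshold_eq hθ)]
  fun_prop

lemma abs_softThreshold_sub_le {θ : ℝ} (hθ : 0 ≤ θ) (x : ℝ) : |softThreshold θ x - x| ≤ θ := by
  rw [softThreshold_eq hθ, abs_le]
  rcases max_cases (x - θ) 0 with h1 | h1 <;> rcases max_cases (-x - θ) 0 with h2 | h2 <;>
    constructor <;> linarith

lemma abs_softThreshold_add_sub_le {θ : ℝ} (hθ : 0 ≤ θ) (x w : ℝ) :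
    |softThreshold θ (x + w) - x| ≤ θ + |w| := by
  have h1 := abs_softThreshold_sub_le hθ (x + w)
  have h2 := abs_add_le (softThreshold θ (x + w) - (x + w)) w
  rw [show softThreshold θ (x + w) - (x + w) + w = softThreshold θ (x + w) - x by ring] at h2
  linarith

/-- Where the output is nonzero, the residual is `θ` times its sign. With `|residual| ≤ θ`, this
says that residual over `θ` is a subgradient of `|·|` at the output. -/
lemma sub_softThreshold_mul_self {θ : ℝ} (hθ : 0 ≤ θ) (x : ℝ) :
    (x - softThreshold θ x) * softThreshold θ x = θ * |softThreshold θ x| := by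
  rw [softThreshold_eq hθ]
  rcases max_cases (x - θ) 0 with h1 | h1 <;> rcases max_cases (-x - θ) 0 with h2 | h2 <;>
    rw [h1.1, h2.1]
  · have : x = 0 := by linarith
    have : θ = 0 := by linarith
    subst this; subst x; simp
  · rw [abs_of_nonneg (by linarith)]; ring
  · rw [abs_of_nonpos (by linarith)]; ring
  · simp

/-- The rescaled residuals of soft thresholding are subgradients of the absolute value, and hence
monotone. -/
lemma softThreshold_monotone {θ₁ θ₂ : ℝ} (h₁ : 0 < θ₁) (h₂ : 0 < θ₂) (x₁ x₂ : ℝ) :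
    0 ≤ ((x₁ - softThreshold θ₁ x₁) / θ₁ - (x₂ - softThreshold θ₂ x₂) / θ₂) *
      (softThreshold θ₁ x₁ - softThreshold θ₂ x₂) := by
  have key : ∀ {θ : ℝ}, 0 < θ → ∀ x, (x - softThreshold θ x) / θ * softThreshold θ x =
      |softThreshold θ x| ∧ |(x - softThreshold θ x) / θ| ≤ 1 := fun {θ} hθ x => by
    constructor
    · rw [div_mul_eq_mul_div, sub_softThreshold_mul_self hθ.le]
      field_simp
    · rw [abs_div, abs_of_pos hθ, div_le_one hθ, abs_sub_comm]
      exact abs_softThreshold_sub_le hθ.le x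
  obtain ⟨e₁, b₁⟩ := key h₁ x₁
  obtain ⟨e₂, b₂⟩ := key h₂ x₂
  have bound : ∀ p w : ℝ, |p| ≤ 1 → p * w ≤ |w| := fun p w hp =>
    (le_abs_self _).trans (by rw [abs_mul]; exact mul_le_of_le_one_left (abs_nonneg _) hp)
  have c₁ := bound _ (softThreshold θ₂ x₂) b₁
  have c₂ := bound _ (softThreshold θ₁ x₁) b₂
  nlinarith

lemma softThreshold_add_sub_eq {α : ℝ} (hα : 0 ≤ α) (u w : ℝ) :
    softThreshold α (u + w) - u = -u + (Set.Ioi (α - u)).indicator (fun w => w + (u - α)) w +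
      (Set.Iio (-α - u)).indicator (fun w => w + (u + α)) w := by
  rw [softThreshold_eq hα]
  simp only [Set.indicator, Set.mem_Ioi, Set.mem_Iio]
  rcases max_cases (u + w - α) 0 with h1 | h1 <;> rcases max_cases (-(u + w) - α) 0 with h2 | h2 <;>
    rw [h1.1, h2.1] <;> split_ifs <;> linarith

/-! ### Selection probability and risk at a fixed signal -/

/-- `ℙ(|u + W| > α)` for a standard normal `W`. -/
@[irreducible] noncomputable def excess (α u : ℝ) : ℝ := Phi (u - α) + Phi (-u - α)

/-- `𝔼 (η_α(u + W) - u)²` for a standard normal `W`. -/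
@[irreducible] noncomputable def scalarRisk (α u : ℝ) : ℝ :=
  u ^ 2 * (1 - excess α u) + (1 + α ^ 2) * excess α u - (α + u) * phi (α - u) -
    (α - u) * phi (α + u)

lemma continuous_excess : Continuous fun p : ℝ × ℝ => excess p.1 p.2 := by
  have := continuous_Phi
  unfold excess
  fun_prop

lemma continuous_scalarRisk : Continuous fun p : ℝ × ℝ => scalarRisk p.1 p.2 := by
  have := continuous_phi
  have := continuous_excess
  unfold scalarRisk
  fun_prop

lemma integrable_indicator_quadratic (a b c : ℝ) {S : Set ℝ} (hS : MeasurableSet S) :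
    Integrable (S.indicator fun w : ℝ => a * w ^ 2 + b * w + c) stdNormal :=
  (integrable_quadratic_stdNormal a b c).indicator hS

lemma integral_two_tails {s t : ℝ} (a b c a₁ b₁ c₁ a₂ b₂ c₂ : ℝ) :
    ∫ w, ((a * w ^ 2 + b * w + c) +
      (Set.Ioi s).indicator (fun w : ℝ => a₁ * w ^ 2 + b₁ * w + c₁) w +
      (Set.Iio t).indicator (fun w : ℝ => a₂ * w ^ 2 + b₂ * w + c₂) w) ∂stdNormal =
      (a + c) + (a₁ * (Phi (-s) + s * phi s) + b₁ * phi s + c₁ * Phi (-s)) +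
        (a₂ * (Phi t - t * phi t) - b₂ * phi t + c₂ * Phi t) := by
  have i0 := integrable_quadratic_stdNormal a b c
  have i1 := integrable_indicator_quadratic a₁ b₁ c₁ (measurableSet_Ioi (a := s))
  have i2 := integrable_indicator_quadratic a₂ b₂ c₂ (measurableSet_Iio (a := t))
  have i01 : Integrable (fun w : ℝ => (a * w ^ 2 + b * w + c) +
      (Set.Ioi s).indicator (fun w : ℝ => a₁ * w ^ 2 + b₁ * w + c₁) w) stdNormal := i0.add i1
  rw [integral_add i01 i2, integral_add i0 i1, integral_quadratic, integral_Ioi_quadratic,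
    integral_Iio_quadratic]

lemma integral_sq_softThreshold {α : ℝ} (hα : 0 ≤ α) (u : ℝ) :
    ∫ w, (softThreshold α (u + w) - u) ^ 2 ∂stdNormal = scalarRisk α u := by
  have h : ∀ w, (softThreshold α (u + w) - u) ^ 2 = (0 * w ^ 2 + 0 * w + u ^ 2) +
      (Set.Ioi (α - u)).indicator (fun w => 1 * w ^ 2 + (-2 * α) * w + (α ^ 2 - u ^ 2)) w +
      (Set.Iio (-α - u)).indicator (fun w => 1 * w ^ 2 + (2 * α) * w + (α ^ 2 - u ^ 2)) w := by
    intro w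
    rw [softThreshold_add_sub_eq hα]
    simp only [Set.indicator, Set.mem_Ioi, Set.mem_Iio]
    split_ifs
    · exfalso; linarith
    all_goals ring
  simp only [h]
  rw [integral_two_tails, scalarRisk, excess, show -α - u = -(α + u) by ring, phi_neg,
    show -(α - u) = u - α by ring, show -(α + u) = -u - α by ring]
  ring

/-- Stein's identity for the soft threshold, whose derivative is the indicator of selection. It
turns the calibration equation into a statement about the correlation of the error with the noise.
-/
lemma integral_mul_softThreshold {α : ℝ} (hα : 0 ≤ α) (u : ℝ) :
    ∫ w, w * (softThreshold α (u + w) - u) ∂stdNormal = excess α u := by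
  have h : ∀ w, w * (softThreshold α (u + w) - u) = (0 * w ^ 2 + (-u) * w + 0) +
      (Set.Ioi (α - u)).indicator (fun w => 1 * w ^ 2 + (u - α) * w + 0) w +
      (Set.Iio (-α - u)).indicator (fun w => 1 * w ^ 2 + (u + α) * w + 0) w := by
    intro w
    rw [softThreshold_add_sub_eq hα]
    simp only [Set.indicator, Set.mem_Ioi, Set.mem_Iio]
    split_ifs <;> ring
  simp only [h]
  rw [integral_two_tails, excess, show -α - u = -(α + u) by ring, phi_neg,
    show -(α - u) = u - α by ring, show -(α + u) = -u - α by ring]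
  ring

lemma measureReal_abs_add_gt {α : ℝ} (hα : 0 ≤ α) (u : ℝ) :
    stdNormal.real {w | α < |u + w|} = excess α u := by
  have hm : MeasurableSet {w : ℝ | α < |u + w|} :=
    measurableSet_lt measurable_const (by fun_prop)
  rw [← integral_indicator_one hm]
  have h : ∀ w, {w : ℝ | α < |u + w|}.indicator (1 : ℝ → ℝ) w = (0 * w ^ 2 + 0 * w + 0) +
      (Set.Ioi (α - u)).indicator (fun w => 0 * w ^ 2 + 0 * w + 1) w +
      (Set.Iio (-α - u)).indicator (fun w => 0 * w ^ 2 + 0 * w + 1) w := by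
    intro w
    simp only [Set.indicator, Set.mem_Ioi, Set.mem_Iio, Set.mem_ofPred_eq, lt_abs, Pi.one_apply]
    split_ifs with h1 h2 h3 h3 h2 h3 h3
    · exfalso; linarith
    · ring
    · ring
    · exfalso; rcases h1 with h1 | h1
      · exact h2 (by linarith)
      · exact h3 (by linarith)
    · exact absurd (Or.inl (by linarith)) h1
    · exact absurd (Or.inl (by linarith)) h1
    · exact absurd (Or.inr (by linarith)) h1
    · ring
  simp only [h]
  rw [integral_two_tails, excess, show -(α - u) = u - α by ring, show -α - u = -u - α by ring]
  ring

lemma excess_pos (α u : ℝ) : 0 < excess α u := by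
  rw [excess]
  exact add_pos (Phi_pos _) (Phi_pos _)

lemma excess_nonneg (α u : ℝ) : 0 ≤ excess α u := (excess_pos α u).le

lemma one_sub_excess (α u : ℝ) : 1 - excess α u = Phi (α - u) - Phi (-u - α) := by
  have := Phi_neg (α - u)
  rw [neg_sub] at this
  rw [excess, this]
  ring

lemma excess_le_one {α : ℝ} (hα : 0 ≤ α) (u : ℝ) : excess α u ≤ 1 := by
  have := strictMono_Phi.monotone (by linarith : -u - α ≤ α - u)
  have := one_sub_excess α u
  linarith

lemma excess_lt_one {α : ℝ} (hα : 0 < α) (u : ℝ) : excess α u < 1 := by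
  have := strictMono_Phi (by linarith : -u - α < α - u)
  have := one_sub_excess α u
  linarith

/-- The complementary event is an interval of length `2 α`, and the density is at most `1 / 2`. The
bound is uniform in `u`. -/
lemma one_sub_le_excess {α : ℝ} (hα : 0 ≤ α) (u : ℝ) : 1 - α ≤ excess α u := by
  have := Phi_sub_le (by linarith : -u - α ≤ α - u)
  have := one_sub_excess α u
  linarith

lemma excess_neg (α u : ℝ) : excess α (-u) = excess α u := by
  rw [excess, excess, neg_neg, add_comm]

lemma scalarRisk_neg (α u : ℝ) : scalarRisk α (-u) = scalarRisk α u := by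
  rw [scalarRisk, scalarRisk, excess_neg, sub_neg_eq_add, ← sub_eq_add_neg]
  ring

lemma scalarRisk_abs (α u : ℝ) : scalarRisk α |u| = scalarRisk α u := by
  rcases abs_choice u with h | h <;> rw [h]
  exact scalarRisk_neg α u

lemma excess_abs (α u : ℝ) : excess α |u| = excess α u := by
  rcases abs_choice u with h | h <;> rw [h]
  exact excess_neg α u

lemma excess_zero_right (α : ℝ) : excess α 0 = 2 * Phi (-α) := by
  simp [excess]; ring

lemma hasDerivAt_excess (α u : ℝ) :
    HasDerivAt (excess α) (phi (α - u) - phi (α + u)) u := by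
  have h1 := (hasDerivAt_Phi (u - α)).comp u ((hasDerivAt_id u).sub_const α)
  have h2 := (hasDerivAt_Phi (-u - α)).comp u ((hasDerivAt_id u).neg.sub_const α)
  rw [show excess α = fun u => Phi (u - α) + Phi (-u - α) from funext fun u => by rw [excess]]
  refine (h1.add h2).congr_deriv ?_
  rw [← phi_neg (u - α), ← phi_neg (-u - α), neg_sub, show -(-u - α) = α + u by ring]
  ring

/-- All density terms cancel and `2 u ℙ(|u + W| ≤ α)` remains. Hence the risk increases with `|u|`,
but no faster than `u ^ 2`. -/
lemma hasDerivAt_scalarRisk (α u : ℝ) :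
    HasDerivAt (scalarRisk α) (2 * u * (1 - excess α u)) u := by
  have he := hasDerivAt_excess α u
  have h1 := (hasDerivAt_phi (α - u)).comp u ((hasDerivAt_id u).const_sub α)
  have h2 := (hasDerivAt_phi (α + u)).comp u ((hasDerivAt_id u).const_add α)
  have h3 := ((((hasDerivAt_pow 2 u).mul (he.const_sub 1)).add (he.const_mul (1 + α ^ 2))).sub
    (((hasDerivAt_id u).const_add α).mul h1)).sub (((hasDerivAt_id u).const_sub α).mul h2)
  rw [show scalarRisk α = fun u => u ^ 2 * (1 - excess α u) + (1 + α ^ 2) * excess α u -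
    (α + u) * phi (α - u) - (α - u) * phi (α + u) from funext fun u => by rw [scalarRisk]]
  refine h3.congr_deriv ?_
  simp only [Function.comp, id]
  push_cast
  ring

lemma excess_zero_le {α : ℝ} (hα : 0 ≤ α) (u : ℝ) : excess α 0 ≤ excess α u := by
  rw [← excess_abs α u]
  have hm : MonotoneOn (excess α) (Set.Ici 0) := by
    refine monotoneOn_of_hasDerivWithinAt_nonneg (convex_Ici 0)
      (f' := fun u => phi (α - u) - phi (α + u))
      (fun x _ => (hasDerivAt_excess α x).continuousAt.continuousWithinAt)
      (fun x _ => (hasDerivAt_excess α x).hasDerivWithinAt) fun x hx => ?_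
    rw [interior_Ici] at hx
    have hx : 0 < x := hx
    refine sub_nonneg.2 (phi_le_phi ?_)
    rw [abs_of_pos (by linarith : 0 < α + x), abs_le]
    constructor <;> linarith
  exact hm (by simp) (by simp) (abs_nonneg u)

lemma scalarRisk_strictMonoOn {α : ℝ} (hα : 0 < α) : StrictMonoOn (scalarRisk α) (Set.Ici 0) := by
  refine strictMonoOn_of_hasDerivWithinAt_pos (convex_Ici 0)
    (f' := fun u => 2 * u * (1 - excess α u))
    (fun x _ => (hasDerivAt_scalarRisk α x).continuousAt.continuousWithinAt)
    (fun x _ => (hasDerivAt_scalarRisk α x).hasDerivWithinAt) fun x hx => ?_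
  rw [interior_Ici] at hx
  have hx : 0 < x := hx
  have := excess_lt_one hα x
  have : 0 < 1 - excess α x := by linarith
  positivity

lemma scalarRisk_lt {α u v : ℝ} (hα : 0 < α) (h : |u| < |v|) : scalarRisk α u < scalarRisk α v := by
  rw [← scalarRisk_abs α u, ← scalarRisk_abs α v]
  exact scalarRisk_strictMonoOn hα (abs_nonneg u) (abs_nonneg v) h

lemma scalarRisk_le {α u v : ℝ} (hα : 0 < α) (h : |u| ≤ |v|) : scalarRisk α u ≤ scalarRisk α v := by
  rw [← scalarRisk_abs α u, ← scalarRisk_abs α v]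
  exact (scalarRisk_strictMonoOn hα).monotoneOn (abs_nonneg u) (abs_nonneg v) h

lemma scalarRisk_zero_le {α : ℝ} (hα : 0 < α) (u : ℝ) : scalarRisk α 0 ≤ scalarRisk α u :=
  scalarRisk_le hα (by simp)

lemma scalarRisk_le_add_sq (α u : ℝ) : scalarRisk α u ≤ scalarRisk α 0 + u ^ 2 := by
  rw [← scalarRisk_abs α u, ← sq_abs u]
  have hm : MonotoneOn (fun u => u ^ 2 - scalarRisk α u) (Set.Ici 0) := by
    refine monotoneOn_of_hasDerivWithinAt_nonneg (convex_Ici 0)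
      (f' := fun u => 2 * u - 2 * u * (1 - excess α u))
      (fun x _ => ?_) (fun x _ => HasDerivAt.hasDerivWithinAt ?_) fun x hx => ?_
    · exact (by fun_prop : ContinuousAt (fun u : ℝ => u ^ 2) x).sub
        (hasDerivAt_scalarRisk α x).continuousAt |>.continuousWithinAt
    · exact ((hasDerivAt_pow 2 x).sub (hasDerivAt_scalarRisk α x)).congr_deriv (by simp)
    · rw [interior_Ici] at hx
      have hx : 0 < x := hx
      have := excess_nonneg α x
      nlinarith [mul_nonneg hx.le this]
  have := hm (by simp) (by simp) (abs_nonneg u)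
  simp only at this
  linarith

lemma integrable_sq_softThreshold {α : ℝ} (hα : 0 ≤ α) (u : ℝ) :
    Integrable (fun w => (softThreshold α (u + w) - u) ^ 2) stdNormal := by
  refine (integrable_quadratic_stdNormal 2 0 (2 * α ^ 2)).mono'
    (((continuous_softThreshold hα).comp (by fun_prop)).sub continuous_const |>.pow
      2).aestronglyMeasurable (ae_of_all _ fun w => ?_)
  rw [Real.norm_of_nonneg (sq_nonneg _), ← sq_abs]
  have h := abs_softThreshold_add_sub_le hα u w
  have h0 := abs_nonneg (softThreshold α (u + w) - u)
  have := sq_abs w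
  nlinarith [sq_nonneg (α - |w|)]

lemma scalarRisk_nonneg {α : ℝ} (hα : 0 ≤ α) (u : ℝ) : 0 ≤ scalarRisk α u := by
  rw [← integral_sq_softThreshold hα]
  exact integral_nonneg fun w => sq_nonneg _

/-- A large signal is always selected and shrunk by `α`, so the error tends to `W - α`. -/
lemma tendsto_scalarRisk_atTop {α : ℝ} (hα : 0 ≤ α) :
    Tendsto (scalarRisk α) atTop (𝓝 (1 + α ^ 2)) := by
  have h1 : ∫ w, (w - α) ^ 2 ∂stdNormal = 1 + α ^ 2 := by
    rw [← integral_quadratic 1 (-2 * α) (α ^ 2)]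
    congr 1; ext w; ring
  rw [← h1, ← funext (integral_sq_softThreshold hα)]
  refine tendsto_integral_filter_of_dominated_convergence
    (fun w => 2 * w ^ 2 + 0 * w + 2 * α ^ 2)
    (Eventually.of_forall fun u => (integrable_sq_softThreshold hα u).aestronglyMeasurable)
    (Eventually.of_forall fun u => ae_of_all _ fun w => ?_)
    (integrable_quadratic_stdNormal 2 0 (2 * α ^ 2)) (ae_of_all _ fun w => ?_)
  · rw [Real.norm_of_nonneg (sq_nonneg _), ← sq_abs]
    have h := abs_softThreshold_add_sub_le hα u w
    have h0 := abs_nonneg (softThreshold α (u + w) - u)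
    have := sq_abs w
    nlinarith [sq_nonneg (α - |w|)]
  · refine tendsto_const_nhds.congr' ?_
    filter_upwards [eventually_ge_atTop (α - w)] with u hu
    rw [softThreshold_eq hα, max_eq_left (by linarith), max_eq_right (by linarith)]
    ring

lemma scalarRisk_le_one_add_sq {α : ℝ} (hα : 0 < α) (u : ℝ) : scalarRisk α u ≤ 1 + α ^ 2 :=
  ge_of_tendsto (tendsto_scalarRisk_atTop hα.le) <| by
    filter_upwards [eventually_ge_atTop |u|] with v hv
    exact scalarRisk_le hα (hv.trans (le_abs_self v))

/-- Chebyshev's inequality for `(u + W) ^ 2`. -/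
lemma excess_le_div_sq {α : ℝ} (hα : 0 < α) (u : ℝ) : excess α u ≤ (1 + u ^ 2) / α ^ 2 := by
  have hm : MeasurableSet {w : ℝ | α < |u + w|} :=
    measurableSet_lt measurable_const (by fun_prop)
  have h : ∫ w, ((1 / α ^ 2) * w ^ 2 + (2 * u / α ^ 2) * w + u ^ 2 / α ^ 2) ∂stdNormal =
      (1 + u ^ 2) / α ^ 2 := by
    rw [integral_quadratic]; ring
  rw [← measureReal_abs_add_gt hα.le, ← integral_indicator_one hm, ← h]
  refine integral_mono ((integrable_const 1).indicator hm) (integrable_quadratic_stdNormal _ _ _)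
    fun w => ?_
  have e : (1 / α ^ 2) * w ^ 2 + (2 * u / α ^ 2) * w + u ^ 2 / α ^ 2 = (u + w) ^ 2 / α ^ 2 := by
    ring
  show _ ≤ (1 / α ^ 2) * w ^ 2 + (2 * u / α ^ 2) * w + u ^ 2 / α ^ 2
  rw [e]
  refine Set.indicator_apply_le' (fun hw => ?_) fun _ => by positivity
  have hw : α < |u + w| := hw
  rw [Pi.one_apply, le_div_iff₀ (by positivity), one_mul, ← sq_abs (u + w)]
  gcongr

/-- When the signal is not selected, the error is exactly `-u`. -/
lemma sq_mul_le_scalarRisk {α : ℝ} (hα : 0 ≤ α) (u : ℝ) :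
    u ^ 2 * (1 - excess α u) ≤ scalarRisk α u := by
  have hm : MeasurableSet {w : ℝ | α < |u + w|} :=
    measurableSet_lt measurable_const (by fun_prop)
  rw [← integral_sq_softThreshold hα, ← measureReal_abs_add_gt hα, ← probReal_compl_eq_one_sub hm,
    ← integral_indicator_one hm.compl, ← integral_const_mul]
  refine integral_mono (((integrable_const 1).indicator hm.compl).const_mul _)
    (integrable_sq_softThreshold hα u) fun w => ?_
  by_cases h : α < |u + w|
  · simp only [Set.indicator, Set.mem_compl_iff, Set.mem_ofPred_eq, h, not_true_eq_false, if_false,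
      mul_zero]
    positivity
  · simp only [Set.indicator, Set.mem_compl_iff, Set.mem_ofPred_eq, h, not_false_eq_true, if_true]
    have h := abs_le.1 (not_lt.1 h)
    rw [softThreshold_eq hα, max_eq_right (by linarith), max_eq_right (by linarith)]
    simp

/-! ### The risk at zero signal and the Donoho–Tanner function -/

/-- The expected overshoot `𝔼 (W - t)₊`. -/
noncomputable def overshoot (t : ℝ) : ℝ := phi t - t * Phi (-t)

lemma hasDerivAt_Phi_neg (t : ℝ) : HasDerivAt (fun t => Phi (-t)) (-phi t) t :=
  ((hasDerivAt_Phi (-t)).comp t (hasDerivAt_neg t)).congr_deriv (by rw [phi_neg]; ring)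

lemma hasDerivAt_overshoot (t : ℝ) : HasDerivAt overshoot (-Phi (-t)) t :=
  ((hasDerivAt_phi t).sub ((hasDerivAt_id t).mul (hasDerivAt_Phi_neg t))).congr_deriv
    (by simp)

lemma strictAnti_overshoot : StrictAnti overshoot :=
  strictAnti_of_hasDerivAt_neg hasDerivAt_overshoot fun _ => neg_neg_of_pos (Phi_pos _)

lemma overshoot_nonneg (t : ℝ) : 0 ≤ overshoot t := by
  have h := integral_Ioi_quadratic 0 1 (-t) t
  have h2 : 0 ≤ ∫ w, (Set.Ioi t).indicator (fun w : ℝ => 0 * w ^ 2 + 1 * w + -t) w ∂stdNormal := by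
    refine integral_nonneg fun w => Set.indicator_nonneg (fun w hw => ?_) w
    have hw : t < w := hw
    linarith
  rw [h] at h2
  rw [overshoot]
  linarith

lemma overshoot_pos (t : ℝ) : 0 < overshoot t :=
  (overshoot_nonneg (t + 1)).trans_lt (strictAnti_overshoot (by linarith))

lemma scalarRisk_zero_eq (t : ℝ) :
    scalarRisk t 0 = 2 * ((1 + t ^ 2) * Phi (-t) - t * phi t) := by
  rw [scalarRisk, excess_zero_right]
  simp; ring

/-- The gap between risk and selection probability at zero signal is `-t / 2 * (-4 * overshoot t)`,
that is, `t / 2` times minus the derivative of the risk. The tangency identity at the phase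
transition rests on this. -/
lemma scalarRisk_zero_eq_sub (t : ℝ) : scalarRisk t 0 = excess t 0 - 2 * t * overshoot t := by
  rw [scalarRisk_zero_eq, excess_zero_right, overshoot]
  ring

lemma scalarRisk_zero_zero : scalarRisk 0 0 = 1 := by
  rw [scalarRisk_zero_eq, neg_zero, Phi_zero]; norm_num

lemma hasDerivAt_scalarRisk_zero (t : ℝ) :
    HasDerivAt (fun t => scalarRisk t 0) (-4 * overshoot t) t := by
  rw [funext scalarRisk_zero_eq]
  have h := (((((hasDerivAt_pow 2 t).const_add 1).mul (hasDerivAt_Phi_neg t)).sub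
    (hasDerivAt_mul_phi t)).const_mul 2)
  refine h.congr_deriv ?_
  rw [overshoot]
  push_cast
  ring

lemma strictAnti_scalarRisk_zero : StrictAnti fun t => scalarRisk t 0 :=
  strictAnti_of_hasDerivAt_neg hasDerivAt_scalarRisk_zero fun t => by
    have := overshoot_pos t
    linarith

lemma convexOn_scalarRisk_zero : ConvexOn ℝ Set.univ fun t => scalarRisk t 0 := by
  have hd : deriv (fun t => scalarRisk t 0) = fun t => -4 * overshoot t :=
    funext fun t => (hasDerivAt_scalarRisk_zero t).deriv
  refine MonotoneOn.convexOn_of_deriv convex_univ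
    (fun t _ => (hasDerivAt_scalarRisk_zero t).continuousAt.continuousWithinAt)
    (fun t _ => (hasDerivAt_scalarRisk_zero t).differentiableAt.differentiableWithinAt) ?_
  rw [hd]
  intro a _ b _ hab
  have := strictAnti_overshoot.antitone hab
  simp only
  linarith

lemma scalarRisk_zero_lt_excess {t : ℝ} (ht : 0 < t) : scalarRisk t 0 < excess t 0 := by
  rw [scalarRisk_zero_eq_sub]
  have := mul_pos ht (overshoot_pos t)
  linarith

lemma scalarRisk_zero_lt_div_sq {t : ℝ} (ht : 0 < t) : scalarRisk t 0 < 1 / t ^ 2 :=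
  (scalarRisk_zero_lt_excess ht).trans_le ((excess_le_div_sq ht 0).trans_eq (by simp))

lemma scalarRisk_zero_le_one {t : ℝ} (ht : 0 ≤ t) : scalarRisk t 0 ≤ 1 :=
  (strictAnti_scalarRisk_zero.antitone ht).trans_eq scalarRisk_zero_zero

lemma dtFun_eq (e t : ℝ) : dtFun e t = (1 - e) * scalarRisk t 0 + e * (1 + t ^ 2) := by
  rw [dtFun, scalarRisk_zero_eq]; ring

lemma hasDerivAt_dtFun (e t : ℝ) :
    HasDerivAt (dtFun e) ((1 - e) * (-4 * overshoot t) + e * (2 * t)) t := by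
  rw [funext (dtFun_eq e)]
  exact (((hasDerivAt_scalarRisk_zero t).const_mul (1 - e)).add
    (((hasDerivAt_pow 2 t).const_add 1).const_mul e)).congr_deriv (by simp)

/-! ### Averages over the prior -/

/-- The unscaled estimation error `η_{ατ}(x + τ w) - x` at `z = (x, w)`. -/
noncomputable def thresholdError (α τ : ℝ) (z : ℝ × ℝ) : ℝ :=
  softThreshold (α * τ) (z.1 + τ * z.2) - z.1

lemma thresholdError_eq {α τ : ℝ} (hα : 0 ≤ α) (hτ : 0 < τ) (x w : ℝ) :
    thresholdError α τ (x, w) = τ * (softThreshold α (x / τ + w) - x / τ) := by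
  rw [thresholdError, softThreshold_mul hα hτ]
  field_simp

lemma continuous_thresholdError {α τ : ℝ} (hα : 0 ≤ α) (hτ : 0 < τ) :
    Continuous (thresholdError α τ) :=
  ((continuous_softThreshold (by positivity)).comp (by fun_prop)).sub continuous_fst

section
variable (ν : Measure ℝ) [IsProbabilityMeasure ν]

lemma memLp_snd_prod : MemLp (fun z : ℝ × ℝ => z.2) 2 (ν.prod stdNormal) :=
  memLp_id_stdNormal.comp_measurePreserving measurePreserving_snd

lemma memLp_thresholdError {α τ : ℝ} (hα : 0 ≤ α) (hτ : 0 < τ) :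
    MemLp (thresholdError α τ) 2 (ν.prod stdNormal) := by
  have h : MemLp (fun z : ℝ × ℝ => α * τ + τ * |z.2|) 2 (ν.prod stdNormal) :=
    (memLp_const (α * τ)).add (MemLp.const_mul (memLp_snd_prod ν).abs τ)
  refine h.of_le (continuous_thresholdError hα hτ).aestronglyMeasurable (ae_of_all _ fun z => ?_)
  have h1 := abs_softThreshold_add_sub_le (by positivity : 0 ≤ α * τ) z.1 (τ * z.2)
  rw [abs_mul, abs_of_pos hτ] at h1
  rw [Real.norm_eq_abs, Real.norm_eq_abs]
  exact h1.trans (le_abs_self _)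

lemma integrable_thresholdError_mul {α τ α' τ' : ℝ} (hα : 0 ≤ α) (hτ : 0 < τ) (hα' : 0 ≤ α')
    (hτ' : 0 < τ') :
    Integrable (fun z => thresholdError α τ z * thresholdError α' τ' z) (ν.prod stdNormal) :=
  (memLp_thresholdError ν hα hτ).integrable_mul (memLp_thresholdError ν hα' hτ')

lemma integrable_snd_mul_thresholdError {α τ : ℝ} (hα : 0 ≤ α) (hτ : 0 < τ) :
    Integrable (fun z => z.2 * thresholdError α τ z) (ν.prod stdNormal) :=
  (memLp_snd_prod ν).integrable_mul (memLp_thresholdError ν hα hτ)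

/-- `𝔼 (η_α(X / τ + W) - X / τ)²`. -/
noncomputable def meanRisk (ν : Measure ℝ) (α τ : ℝ) : ℝ := ∫ x, scalarRisk α (x / τ) ∂ν

/-- `ℙ(|X / τ + W| > α)`. -/
noncomputable def meanExcess (ν : Measure ℝ) (α τ : ℝ) : ℝ := ∫ x, excess α (x / τ) ∂ν

lemma thresholdRisk_eq {α τ : ℝ} (hα : 0 ≤ α) (hτ : 0 < τ) :
    thresholdRisk ν α τ = τ ^ 2 * meanRisk ν α τ := by
  have h := (memLp_thresholdError ν hα hτ).integrable_sq
  show ∫ z, (thresholdError α τ z) ^ 2 ∂(ν.prod stdNormal) = _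
  rw [integral_prod _ h, meanRisk, ← integral_const_mul]
  congr 1; ext x
  rw [← integral_sq_softThreshold hα, ← integral_const_mul]
  congr 1; ext w
  rw [thresholdError_eq hα hτ, mul_pow]

lemma integral_snd_mul_thresholdError {α τ : ℝ} (hα : 0 ≤ α) (hτ : 0 < τ) :
    ∫ z, z.2 * thresholdError α τ z ∂(ν.prod stdNormal) = τ * meanExcess ν α τ := by
  rw [integral_prod _ (integrable_snd_mul_thresholdError ν hα hτ), meanExcess, ← integral_const_mul]
  congr 1; ext x
  rw [← integral_mul_softThreshold hα, ← integral_const_mul]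
  congr 1; ext w
  rw [thresholdError_eq hα hτ]
  ring

lemma selectionProb_eq {α τ : ℝ} (hα : 0 ≤ α) (hτ : 0 < τ) :
    selectionProb ν α τ = meanExcess ν α τ := by
  have hm : MeasurableSet {z : ℝ × ℝ | α * τ < |z.1 + τ * z.2|} :=
    measurableSet_lt measurable_const (by fun_prop)
  rw [selectionProb, ← integral_indicator_one hm,
    integral_prod _ ((integrable_const 1).indicator hm), meanExcess]
  congr 1; ext x
  have hm' : MeasurableSet {w : ℝ | α < |x / τ + w|} :=
    measurableSet_lt measurable_const (by fun_prop)
  rw [← measureReal_abs_add_gt hα, ← integral_indicator_one hm']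
  congr 1; ext w
  have h : α * τ < |x + τ * w| ↔ α < |x / τ + w| := by
    have : x + τ * w = (x / τ + w) * τ := by field_simp
    rw [this, abs_mul, abs_of_pos hτ, mul_lt_mul_iff_left₀ hτ]
  simp only [Set.indicator, Set.mem_ofPred_eq, h, Pi.one_apply]

lemma tendsto_scalarRisk {ι : Type*} {l : Filter ι} {a u : ι → ℝ} {α v : ℝ}
    (ha : Tendsto a l (𝓝 α)) (hu : Tendsto u l (𝓝 v)) :
    Tendsto (fun i => scalarRisk (a i) (u i)) l (𝓝 (scalarRisk α v)) := by
  have h : Tendsto (fun p : ℝ × ℝ => scalarRisk p.1 p.2) (𝓝 (α, v)) (𝓝 (scalarRisk α v)) :=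
    continuous_scalarRisk.tendsto (α, v)
  exact h.comp (ha.prodMk_nhds hu)

lemma tendsto_excess {ι : Type*} {l : Filter ι} {a u : ι → ℝ} {α v : ℝ}
    (ha : Tendsto a l (𝓝 α)) (hu : Tendsto u l (𝓝 v)) :
    Tendsto (fun i => excess (a i) (u i)) l (𝓝 (excess α v)) :=
  (continuous_excess.tendsto (α, v)).comp (ha.prodMk_nhds hu)

lemma continuous_scalarRisk_div (α τ : ℝ) : Continuous fun x => scalarRisk α (x / τ) :=
  continuous_scalarRisk.comp (f := fun x => (α, x / τ)) (by fun_prop)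

lemma continuous_excess_div (α τ : ℝ) : Continuous fun x => excess α (x / τ) :=
  continuous_excess.comp (f := fun x => (α, x / τ)) (by fun_prop)

lemma abs_scalarRisk_le {α : ℝ} (hα : 0 < α) (u : ℝ) : |scalarRisk α u| ≤ 1 + α ^ 2 := by
  rw [abs_of_nonneg (scalarRisk_nonneg hα.le u)]
  exact scalarRisk_le_one_add_sq hα u

lemma abs_excess_le {α : ℝ} (hα : 0 ≤ α) (u : ℝ) : |excess α u| ≤ 1 := by
  rw [abs_of_nonneg (excess_nonneg α u)]
  exact excess_le_one hα u

lemma integrable_scalarRisk_div {α : ℝ} (hα : 0 < α) (τ : ℝ) :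
    Integrable (fun x => scalarRisk α (x / τ)) ν :=
  (integrable_const (1 + α ^ 2)).mono' (continuous_scalarRisk_div α τ).aestronglyMeasurable
    (ae_of_all _ fun _ => abs_scalarRisk_le hα _)

lemma integrable_excess_div {α : ℝ} (hα : 0 ≤ α) (τ : ℝ) :
    Integrable (fun x => excess α (x / τ)) ν :=
  (integrable_const (1 : ℝ)).mono' (continuous_excess_div α τ).aestronglyMeasurable
    (ae_of_all _ fun _ => abs_excess_le hα _)

lemma le_meanExcess {α τ b : ℝ} (hα : 0 ≤ α) (h : ∀ u, b ≤ excess α u) : b ≤ meanExcess ν α τ := by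
  have := integral_mono (integrable_const b) (integrable_excess_div ν hα τ) fun x => h (x / τ)
  rw [meanExcess]
  simpa using this

lemma meanExcess_le_one {α : ℝ} (hα : 0 ≤ α) (τ : ℝ) : meanExcess ν α τ ≤ 1 := by
  have := integral_mono (integrable_excess_div ν hα τ) (integrable_const 1)
    fun x => excess_le_one hα (x / τ)
  rw [meanExcess]
  simpa using this

lemma meanExcess_nonneg {α : ℝ} (hα : 0 ≤ α) (τ : ℝ) : 0 ≤ meanExcess ν α τ :=
  le_meanExcess ν hα fun u => excess_nonneg α u

lemma meanExcess_le_div_sq (hν : Integrable (fun x : ℝ => x ^ 2) ν) {α : ℝ} (hα : 0 < α) (τ : ℝ) :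
    meanExcess ν α τ ≤ (1 + (∫ x, x ^ 2 ∂ν) / τ ^ 2) / α ^ 2 := by
  have hi : Integrable (fun x : ℝ => 1 + x ^ 2 / τ ^ 2) ν :=
    (integrable_const 1).add (hν.div_const (τ ^ 2))
  have h := integral_mono (integrable_excess_div ν hα.le τ) (hi.div_const (α ^ 2)) fun x => by
      simpa only [div_pow] using excess_le_div_sq hα (x / τ)
  rwa [integral_div, integral_add (integrable_const 1) (hν.div_const _), integral_div,
    integral_const, probReal_univ, one_smul] at h

lemma le_meanRisk {α : ℝ} (hα : 0 < α) (τ : ℝ) : scalarRisk α 0 ≤ meanRisk ν α τ := by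
  have := integral_mono (integrable_const (scalarRisk α 0)) (integrable_scalarRisk_div ν hα τ)
    fun x => scalarRisk_zero_le hα (x / τ)
  rw [meanRisk]
  simpa using this

lemma meanRisk_le_one_add_sq {α : ℝ} (hα : 0 < α) (τ : ℝ) : meanRisk ν α τ ≤ 1 + α ^ 2 := by
  have := integral_mono (integrable_scalarRisk_div ν hα τ) (integrable_const (1 + α ^ 2))
    fun x => scalarRisk_le_one_add_sq hα (x / τ)
  rw [meanRisk]
  simpa using this

lemma meanRisk_le_add (hν : Integrable (fun x : ℝ => x ^ 2) ν) {α : ℝ} (hα : 0 < α) (τ : ℝ) :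
    meanRisk ν α τ ≤ scalarRisk α 0 + (∫ x, x ^ 2 ∂ν) / τ ^ 2 := by
  have hi : Integrable (fun x : ℝ => scalarRisk α 0 + x ^ 2 / τ ^ 2) ν :=
    (integrable_const _).add (hν.div_const (τ ^ 2))
  have h := integral_mono (integrable_scalarRisk_div ν hα τ) hi fun x => by
      simpa only [div_pow] using scalarRisk_le_add_sq α (x / τ)
  rwa [integral_add (integrable_const _) (hν.div_const _), integral_div,
    integral_const, probReal_univ, one_smul] at h

lemma tendsto_integral_of_bounded {ι : Type*} {l : Filter ι} [l.IsCountablyGenerated]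
    {F : ι → ℝ → ℝ} {g : ℝ → ℝ} (C : ℝ) (hc : ∀ i, Continuous (F i))
    (hb : ∀ᶠ i in l, ∀ x, |F i x| ≤ C) (hl : ∀ x, Tendsto (fun i => F i x) l (𝓝 (g x))) :
    Tendsto (fun i => ∫ x, F i x ∂ν) l (𝓝 (∫ x, g x ∂ν)) :=
  tendsto_integral_filter_of_dominated_convergence (fun _ => C)
    (Eventually.of_forall fun i => (hc i).aestronglyMeasurable)
    (hb.mono fun _ h => ae_of_all _ h) (integrable_const C) (ae_of_all _ hl)

lemma tendsto_meanRisk {ι : Type*} {l : Filter ι} [l.IsCountablyGenerated] {a τ : ι → ℝ} {α : ℝ}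
    (hα : 0 < α) (ha : Tendsto a l (𝓝 α)) {g : ℝ → ℝ}
    (hg : ∀ x, Tendsto (fun i => scalarRisk (a i) (x / τ i)) l (𝓝 (g x))) :
    Tendsto (fun i => meanRisk ν (a i) (τ i)) l (𝓝 (∫ x, g x ∂ν)) := by
  refine tendsto_integral_of_bounded ν (1 + (α + 1) ^ 2)
    (fun i => continuous_scalarRisk_div (a i) (τ i)) ?_ hg
  filter_upwards [ha.eventually (lt_mem_nhds hα), ha.eventually (gt_mem_nhds (lt_add_one α))]
    with i h1 h2 x
  exact (abs_scalarRisk_le h1 _).trans (by gcongr)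

lemma tendsto_meanExcess {ι : Type*} {l : Filter ι} [l.IsCountablyGenerated] {a τ : ι → ℝ}
    (ha : ∀ᶠ i in l, 0 ≤ a i) {g : ℝ → ℝ}
    (hg : ∀ x, Tendsto (fun i => excess (a i) (x / τ i)) l (𝓝 (g x))) :
    Tendsto (fun i => meanExcess ν (a i) (τ i)) l (𝓝 (∫ x, g x ∂ν)) := by
  refine tendsto_integral_of_bounded ν 1 (fun i => continuous_excess_div (a i) (τ i)) ?_ hg
  filter_upwards [ha] with i h1 x
  exact abs_excess_le h1 _

lemma tendsto_meanRisk_nhds {ι : Type*} {l : Filter ι} [l.IsCountablyGenerated] {a t : ι → ℝ}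
    {α τ : ℝ} (hα : 0 < α) (hτ : τ ≠ 0) (ha : Tendsto a l (𝓝 α)) (ht : Tendsto t l (𝓝 τ)) :
    Tendsto (fun i => meanRisk ν (a i) (t i)) l (𝓝 (meanRisk ν α τ)) :=
  tendsto_meanRisk ν hα ha (g := fun x => scalarRisk α (x / τ)) fun _ =>
    tendsto_scalarRisk ha (tendsto_const_nhds.div ht hτ)

lemma tendsto_meanExcess_nhds {ι : Type*} {l : Filter ι} [l.IsCountablyGenerated] {a t : ι → ℝ}
    {α τ : ℝ} (hα : 0 < α) (hτ : τ ≠ 0) (ha : Tendsto a l (𝓝 α)) (ht : Tendsto t l (𝓝 τ)) :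
    Tendsto (fun i => meanExcess ν (a i) (t i)) l (𝓝 (meanExcess ν α τ)) :=
  tendsto_meanExcess ν ((ha.eventually (lt_mem_nhds hα)).mono fun _ h => h.le)
    (g := fun x => excess α (x / τ)) fun _ => tendsto_excess ha (tendsto_const_nhds.div ht hτ)

lemma tendsto_meanRisk_atTop {α : ℝ} (hα : 0 < α) :
    Tendsto (fun τ => meanRisk ν α τ) atTop (𝓝 (scalarRisk α 0)) := by
  have h := tendsto_meanRisk ν (l := atTop) (a := fun _ => α) (τ := fun τ => τ) hα
    tendsto_const_nhds (g := fun _ => scalarRisk α 0) fun x =>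
    tendsto_scalarRisk tendsto_const_nhds (tendsto_const_nhds.div_atTop tendsto_id)
  simpa [meanRisk] using h

end

/-! ### Vanishing noise level and the atom of the prior at zero -/

lemma tendsto_scalarRisk_div_nhds_zero {α x : ℝ} (hα : 0 ≤ α) (hx : x ≠ 0) :
    Tendsto (fun τ => scalarRisk α (x / τ)) (𝓝[>] 0) (𝓝 (1 + α ^ 2)) := by
  have h1 : Tendsto (fun τ => |x| / τ) (𝓝[>] 0) atTop :=
    (tendsto_inv_nhdsGT_zero.const_mul_atTop (abs_pos.2 hx)).congr fun τ => by
      rw [div_eq_mul_inv]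
  refine ((tendsto_scalarRisk_atTop hα).comp h1).congr' ?_
  filter_upwards [self_mem_nhdsWithin] with τ hτ
  have hτ : 0 < τ := hτ
  rw [Function.comp, ← scalarRisk_abs α (x / τ), abs_div, abs_of_pos hτ]

lemma tendsto_excess_div {ι : Type*} {l : Filter ι} {a t : ι → ℝ} {α x : ℝ}
    (ha : Tendsto a l (𝓝 α)) (ha0 : ∀ᶠ i in l, 0 ≤ a i) (ht : Tendsto t l (𝓝[>] 0)) (hx : x ≠ 0) :
    Tendsto (fun i => excess (a i) (x / t i)) l (𝓝 1) := by
  have h1 : Tendsto (fun i => |x| / t i) l atTop :=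
    ((tendsto_inv_nhdsGT_zero.comp ht).const_mul_atTop (abs_pos.2 hx)).congr fun τ => by
      rw [div_eq_mul_inv, Function.comp]
  have h2 : Tendsto (fun i => Phi (|x| / t i - a i)) l (𝓝 1) := by
    refine tendsto_Phi_atTop.comp ?_
    simpa [sub_eq_add_neg] using h1.atTop_add ha.neg
  refine tendsto_of_tendsto_of_tendsto_of_le_of_le' h2 tendsto_const_nhds ?_
    (ha0.mono fun i hi => excess_le_one hi _)
  filter_upwards [ht.eventually self_mem_nhdsWithin] with i hi
  have hi : 0 < t i := hi
  rw [← excess_abs, abs_div, abs_of_pos hi, excess]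
  have := Phi_nonneg (-(|x| / t i) - a i)
  linarith

lemma ae_nonzeroPart_ne {μ : Measure ℝ} : ∀ᵐ x ∂(nonzeroPart μ), x ≠ 0 :=
  ae_cond_mem (measurableSet_singleton (0 : ℝ)).compl

section
variable {μ : Measure ℝ} [IsProbabilityMeasure μ]

lemma isProbabilityMeasure_nonzeroPart (hε : 0 < sparsity μ) :
    IsProbabilityMeasure (nonzeroPart μ) := by
  refine cond_isProbabilityMeasure fun h => ?_
  rw [sparsity, Measure.real, h] at hε
  simp at hε

lemma sparsity_le_one : sparsity μ ≤ 1 := measureReal_le_one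

/-- Integrals against the prior split into the atom at `0` and the law conditional on being
nonzero. -/
lemma integral_eq_sparsity (hε : 0 < sparsity μ) {f : ℝ → ℝ} (hf : Integrable f μ) :
    ∫ x, f x ∂μ = (1 - sparsity μ) * f 0 + sparsity μ * ∫ x, f x ∂(nonzeroPart μ) := by
  have hm : MeasurableSet ({0}ᶜ : Set ℝ) := (measurableSet_singleton 0).compl
  have h1 : ∫ x, f x ∂(nonzeroPart μ) = (sparsity μ)⁻¹ * ∫ x in {0}ᶜ, f x ∂μ := by
    rw [nonzeroPart, ProbabilityTheory.cond, integral_smul_measure, ENNReal.toReal_inv]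
    rfl
  rw [h1, mul_inv_cancel_left₀ hε.ne',
    ← integral_add_compl (measurableSet_singleton (0 : ℝ)) hf, integral_singleton, sparsity,
    probReal_compl_eq_one_sub (measurableSet_singleton (0 : ℝ))]
  simp

lemma meanExcess_eq_sparsity (hε : 0 < sparsity μ) {α : ℝ} (hα : 0 ≤ α) (τ : ℝ) :
    meanExcess μ α τ = 2 * (1 - sparsity μ) * Phi (-α) +
      sparsity μ * meanExcess (nonzeroPart μ) α τ := by
  rw [meanExcess, integral_eq_sparsity hε (integrable_excess_div μ hα τ), zero_div,
    excess_zero_right, meanExcess]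
  ring

/-- The integrand decreases strictly in `τ` at every `x ≠ 0`, and these points have positive mass.
-/
lemma meanRisk_strictAntiOn (hε : 0 < sparsity μ) {α : ℝ} (hα : 0 < α) :
    StrictAntiOn (meanRisk μ α) (Set.Ioi 0) := by
  intro s hs t _ hst
  have hs : 0 < s := hs
  have hab : ∀ x : ℝ, x ≠ 0 → |x / t| < |x / s| := fun x hx => by
    rw [abs_div, abs_div, abs_of_pos hs, abs_of_pos (hs.trans hst)]
    exact div_lt_div_of_pos_left (abs_pos.2 hx) hs hst
  have hle : ∀ x, scalarRisk α (x / t) ≤ scalarRisk α (x / s) := fun x => by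
    by_cases hx : x = 0
    · simp [hx]
    · exact (scalarRisk_lt hα (hab x hx)).le
  refine (integral_mono (integrable_scalarRisk_div μ hα t) (integrable_scalarRisk_div μ hα s)
    hle).lt_of_ne fun heq => ?_
  rw [integral_eq_iff_of_ae_le (integrable_scalarRisk_div μ hα t)
    (integrable_scalarRisk_div μ hα s) (ae_of_all _ hle)] at heq
  have h0 : μ {0}ᶜ = 0 := by
    refine measure_mono_null (fun x hx => ?_) (ae_iff.1 heq)
    exact (scalarRisk_lt hα (hab x hx)).ne
  rw [sparsity, Measure.real, h0] at hε
  simp at hε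

/-- This is where `dtFun` arises: as `τ → 0` the atom keeps the risk at zero signal, while every
nonzero signal becomes infinitely large and contributes `1 + α ^ 2`. -/
lemma tendsto_meanRisk_nhds_zero (hε : 0 < sparsity μ) {α : ℝ} (hα : 0 < α) :
    Tendsto (fun τ => meanRisk μ α τ) (𝓝[>] 0) (𝓝 (dtFun (sparsity μ) α)) := by
  have := isProbabilityMeasure_nonzeroPart hε
  have h1 : Tendsto (fun τ => meanRisk (nonzeroPart μ) α τ) (𝓝[>] 0) (𝓝 (1 + α ^ 2)) := by
    have h := tendsto_integral_filter_of_dominated_convergence (l := 𝓝[>] (0 : ℝ))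
      (μ := nonzeroPart μ) (F := fun τ x => scalarRisk α (x / τ)) (f := fun _ => 1 + α ^ 2)
      (fun _ => 1 + α ^ 2)
      (Eventually.of_forall fun τ => (continuous_scalarRisk_div α τ).aestronglyMeasurable)
      (Eventually.of_forall fun τ => ae_of_all _ fun x => abs_scalarRisk_le hα _)
      (integrable_const _)
      (ae_nonzeroPart_ne.mono fun x hx => tendsto_scalarRisk_div_nhds_zero hα.le hx)
    simpa [meanRisk] using h
  rw [dtFun_eq]
  refine (tendsto_const_nhds.add (h1.const_mul (sparsity μ))).congr fun τ => ?_
  rw [meanRisk, meanRisk, integral_eq_sparsity hε (integrable_scalarRisk_div μ hα τ), zero_div]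

lemma tendsto_meanExcess_nonzeroPart (hε : 0 < sparsity μ) {ι : Type*} {l : Filter ι}
    [l.IsCountablyGenerated] {a t : ι → ℝ} {α : ℝ} (ha : Tendsto a l (𝓝 α))
    (ha0 : ∀ᶠ i in l, 0 ≤ a i) (ht : Tendsto t l (𝓝[>] 0)) :
    Tendsto (fun i => meanExcess (nonzeroPart μ) (a i) (t i)) l (𝓝 1) := by
  have := isProbabilityMeasure_nonzeroPart hε
  have h := tendsto_integral_filter_of_dominated_convergence (l := l)
      (μ := nonzeroPart μ) (F := fun i x => excess (a i) (x / t i)) (f := fun _ => 1)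
      (fun _ => 1)
      (Eventually.of_forall fun i => (continuous_excess_div (a i) (t i)).aestronglyMeasurable)
      (ha0.mono fun i hi => ae_of_all _ fun x => abs_excess_le hi _)
      (integrable_const _)
      (ae_nonzeroPart_ne.mono fun x hx => tendsto_excess_div ha ha0 ht hx)
  simpa [meanExcess] using h

end

/-! ### Uniqueness of the solution at a given penalty -/

/-- The right-hand side of the state evolution equation divided by `τ²`. -/
noncomputable def stateFun (δ σ : ℝ) (μ : Measure ℝ) (α τ : ℝ) : ℝ :=
  σ ^ 2 / τ ^ 2 + 1 / δ * meanRisk μ α τ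

/-- The penalty that the calibration equation assigns to `(α, τ)`. -/
noncomputable def penalty (δ : ℝ) (μ : Measure ℝ) (α τ : ℝ) : ℝ :=
  (1 - 1 / δ * meanExcess μ α τ) * (α * τ)

lemma sq_mul_meanRisk {δ σ : ℝ} {μ : Measure ℝ} (hδ : 0 < δ) {α τ : ℝ} (hτ : 0 < τ)
    (h : stateFun δ σ μ α τ = 1) :
    τ ^ 2 * meanRisk μ α τ = δ * (τ ^ 2 - σ ^ 2) := by
  rw [stateFun] at h
  field_simp at h
  linarith

lemma mul_meanExcess {δ : ℝ} {μ : Measure ℝ} (hδ : 0 < δ) {α τ lam : ℝ} (hα : 0 < α) (h : lam = penalty δ μ α τ) :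
    τ * meanExcess μ α τ = δ * (τ - lam * (1 / α)) := by
  rw [penalty] at h
  rw [h]
  field_simp
  ring

section
variable {δ σ : ℝ} {μ : Measure ℝ} [IsProbabilityMeasure μ]

lemma isStateSolution_iff {lam α τ : ℝ} : IsStateSolution δ σ μ lam (α, τ) ↔
    0 < α ∧ 0 < τ ∧ stateFun δ σ μ α τ = 1 ∧ lam = penalty δ μ α τ := by
  refine and_congr_right fun hα => and_congr_right fun hτ => ?_
  have hα : 0 < α := hα
  have hτ : 0 < τ := hτ
  simp only [thresholdRisk_eq μ hα.le hτ, selectionProb_eq μ hα.le hτ]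
  refine and_congr ?_ Iff.rfl
  rw [stateFun]
  have h : σ ^ 2 + 1 / δ * (τ ^ 2 * meanRisk μ α τ) =
      τ ^ 2 * (σ ^ 2 / τ ^ 2 + 1 / δ * meanRisk μ α τ) := by
    field_simp
  rw [h]
  constructor
  · intro h
    exact (mul_left_cancel₀ (pow_ne_zero 2 hτ.ne') (by rw [mul_one]; exact h)).symm
  · intro h
    rw [h, mul_one]

lemma stateFun_strictAntiOn (hδ : 0 < δ) (hε : 0 < sparsity μ) {α : ℝ} (hα : 0 < α) :
    StrictAntiOn (stateFun δ σ μ α) (Set.Ioi 0) := by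
  intro s hs t ht hst
  have h1 := meanRisk_strictAntiOn hε hα hs ht hst
  have hs : 0 < s := hs
  have h2 : σ ^ 2 / t ^ 2 ≤ σ ^ 2 / s ^ 2 := by gcongr
  have h3 : 1 / δ * meanRisk μ α t < 1 / δ * meanRisk μ α s := by gcongr
  rw [stateFun, stateFun]
  linarith

lemma integral_thresholdError_comb {α₁ τ₁ α₂ τ₂ : ℝ} (hα₁ : 0 ≤ α₁) (hτ₁ : 0 < τ₁)
    (hα₂ : 0 ≤ α₂) (hτ₂ : 0 < τ₂) (a b c d : ℝ) :
    ∫ z, (a * (z.2 * thresholdError α₁ τ₁ z - z.2 * thresholdError α₂ τ₂ z) +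
      b * thresholdError α₁ τ₁ z ^ 2 + c * thresholdError α₂ τ₂ z ^ 2 +
      d * (thresholdError α₁ τ₁ z * thresholdError α₂ τ₂ z)) ∂(μ.prod stdNormal) =
    a * (τ₁ * meanExcess μ α₁ τ₁ - τ₂ * meanExcess μ α₂ τ₂) + b * (τ₁ ^ 2 * meanRisk μ α₁ τ₁) +
      c * (τ₂ ^ 2 * meanRisk μ α₂ τ₂) +
      d * ∫ z, thresholdError α₁ τ₁ z * thresholdError α₂ τ₂ z ∂(μ.prod stdNormal) := by
  have i1 := integrable_snd_mul_thresholdError μ hα₁ hτ₁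
  have i2 := integrable_snd_mul_thresholdError μ hα₂ hτ₂
  have j0 : Integrable (fun z => a * (z.2 * thresholdError α₁ τ₁ z - z.2 * thresholdError α₂ τ₂ z))
    (μ.prod stdNormal) := (i1.sub i2).const_mul a
  have j1 := (memLp_thresholdError μ hα₁ hτ₁).integrable_sq.const_mul b
  have j2 := (memLp_thresholdError μ hα₂ hτ₂).integrable_sq.const_mul c
  have j3 := (integrable_thresholdError_mul μ hα₁ hτ₁ hα₂ hτ₂).const_mul d
  have k1 : Integrable (fun z => a * (z.2 * thresholdError α₁ τ₁ z - z.2 * thresholdError α₂ τ₂ z) +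
      b * thresholdError α₁ τ₁ z ^ 2) (μ.prod stdNormal) := j0.add j1
  have k2 : Integrable (fun z => a * (z.2 * thresholdError α₁ τ₁ z - z.2 * thresholdError α₂ τ₂ z) +
      b * thresholdError α₁ τ₁ z ^ 2 + c * thresholdError α₂ τ₂ z ^ 2) (μ.prod stdNormal) :=
    k1.add j2
  have e1 : ∫ z, thresholdError α₁ τ₁ z ^ 2 ∂(μ.prod stdNormal) = τ₁ ^ 2 * meanRisk μ α₁ τ₁ :=
    thresholdRisk_eq μ hα₁ hτ₁
  have e2 : ∫ z, thresholdError α₂ τ₂ z ^ 2 ∂(μ.prod stdNormal) = τ₂ ^ 2 * meanRisk μ α₂ τ₂ :=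
    thresholdRisk_eq μ hα₂ hτ₂
  rw [integral_add k2 j3, integral_add k1 j2, integral_add j0 j1, integral_const_mul,
    integral_const_mul, integral_const_mul, integral_const_mul, integral_sub i1 i2,
    integral_snd_mul_thresholdError μ hα₁ hτ₁, integral_snd_mul_thresholdError μ hα₂ hτ₂, e1, e2]

/-- The state evolution and calibration equations have at most one solution at a positive
penalty. -/
theorem isStateSolution_unique (hδ : 0 < δ) (hε : 0 < sparsity μ) {lam : ℝ} (hlam : 0 < lam)
    {p q : ℝ × ℝ} (hp : IsStateSolution δ σ μ lam p) (hq : IsStateSolution δ σ μ lam q) :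
    p = q := by
  obtain ⟨α₁, τ₁⟩ := p
  obtain ⟨α₂, τ₂⟩ := q
  obtain ⟨hα₁, hτ₁, hG₁, hl₁⟩ := isStateSolution_iff.1 hp
  obtain ⟨hα₂, hτ₂, hG₂, hl₂⟩ := isStateSolution_iff.1 hq
  suffices h : 1 / α₁ = 1 / α₂ by
    have hα : α₁ = α₂ := by simpa using h
    subst hα
    have := (stateFun_strictAntiOn hδ hε hα₁).injOn hτ₁ hτ₂ (hG₁.trans hG₂.symm)
    rw [this]
  set B := ∫ z, thresholdError α₁ τ₁ z * thresholdError α₂ τ₂ z ∂(μ.prod stdNormal) with hB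
  -- Write `e₁, e₂` for the two errors. Nonnegativity of `𝔼 (τ₂ e₁ - τ₁ e₂) ^ 2`, together with `δ
  -- σ² (τ₁ - τ₂)² ≥ 0`, bounds the cross moment `B = 𝔼 e₁ e₂`.
  have I₁ : 0 ≤ δ * (2 * τ₁ * τ₂ * (τ₁ * τ₂ - σ ^ 2)) - 2 * τ₁ * τ₂ * B := by
    have h := integral_thresholdError_comb (μ := μ) hα₁.le hτ₁ hα₂.le hτ₂ 0 (τ₂ ^ 2) (τ₁ ^ 2)
      (-(2 * τ₁ * τ₂))
    rw [sq_mul_meanRisk hδ hτ₁ hG₁, sq_mul_meanRisk hδ hτ₂ hG₂] at h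
    have h0 : 0 ≤ ∫ z, (0 * (z.2 * thresholdError α₁ τ₁ z - z.2 * thresholdError α₂ τ₂ z) +
      τ₂ ^ 2 * thresholdError α₁ τ₁ z ^ 2 + τ₁ ^ 2 * thresholdError α₂ τ₂ z ^ 2 +
      -(2 * τ₁ * τ₂) * (thresholdError α₁ τ₁ z * thresholdError α₂ τ₂ z)) ∂(μ.prod stdNormal) := by
      refine integral_nonneg fun z => ?_
      show (0 : ℝ) ≤ _
      nlinarith [sq_nonneg (τ₂ * thresholdError α₁ τ₁ z - τ₁ * thresholdError α₂ τ₂ z)]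
    rw [h] at h0
    have : 0 ≤ δ * σ ^ 2 * (τ₁ - τ₂) ^ 2 := by positivity
    nlinarith
  have hBle : B ≤ δ * (τ₁ * τ₂ - σ ^ 2) := by
    have : 0 ≤ (2 * τ₁ * τ₂) * (δ * (τ₁ * τ₂ - σ ^ 2) - B) := by linarith
    have := nonneg_of_mul_nonneg_right this (by positivity)
    linarith
  -- The coefficients expand the product in `softThreshold_monotone`: the rescaled residual at `(αᵢ,
  -- τᵢ)` is `W / αᵢ - eᵢ / (αᵢ τᵢ)`, and the outputs differ by `e₁ - e₂`.
  have I₂ := integral_thresholdError_comb (μ := μ) hα₁.le hτ₁ hα₂.le hτ₂ (1 / α₁ - 1 / α₂)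
    (-(1 / α₁ * (1 / τ₁))) (-(1 / α₂ * (1 / τ₂))) (1 / α₁ * (1 / τ₁) + 1 / α₂ * (1 / τ₂))
  rw [sq_mul_meanRisk hδ hτ₁ hG₁, sq_mul_meanRisk hδ hτ₂ hG₂, mul_meanExcess hδ hα₁ hl₁,
    mul_meanExcess hδ hα₂ hl₂, ← hB] at I₂
  have h0 : 0 ≤ ∫ z, ((1 / α₁ - 1 / α₂) *
        (z.2 * thresholdError α₁ τ₁ z - z.2 * thresholdError α₂ τ₂ z) +
      -(1 / α₁ * (1 / τ₁)) * thresholdError α₁ τ₁ z ^ 2 +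
      -(1 / α₂ * (1 / τ₂)) * thresholdError α₂ τ₂ z ^ 2 +
      (1 / α₁ * (1 / τ₁) + 1 / α₂ * (1 / τ₂)) *
        (thresholdError α₁ τ₁ z * thresholdError α₂ τ₂ z)) ∂(μ.prod stdNormal) := by
    refine integral_nonneg fun z => ?_
    have h := softThreshold_monotone (mul_pos hα₁ hτ₁) (mul_pos hα₂ hτ₂) (z.1 + τ₁ * z.2)
      (z.1 + τ₂ * z.2)
    refine h.trans_eq ?_
    simp only [thresholdError]
    field_simp
    ring
  rw [I₂] at h0
  have hc : 0 ≤ 1 / α₁ * (1 / τ₁) + 1 / α₂ * (1 / τ₂) := by positivity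
  have h1 := mul_le_mul_of_nonneg_left hBle hc
  -- With `B` replaced by its upper bound, all terms in `τ` and `σ` cancel and only the penalty term
  -- is left. Strict positivity of `lam` then forces equal thresholds.
  have h2 : δ * lam * (1 / α₁ - 1 / α₂) ^ 2 ≤ 0 := by
    have e : (1 / α₁ - 1 / α₂) * (δ * (τ₁ - lam * (1 / α₁)) - δ * (τ₂ - lam * (1 / α₂))) +
      -(1 / α₁ * (1 / τ₁)) * (δ * (τ₁ ^ 2 - σ ^ 2)) + -(1 / α₂ * (1 / τ₂)) * (δ * (τ₂ ^ 2 - σ ^ 2)) +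
      (1 / α₁ * (1 / τ₁) + 1 / α₂ * (1 / τ₂)) * (δ * (τ₁ * τ₂ - σ ^ 2)) =
      -(δ * lam * (1 / α₁ - 1 / α₂) ^ 2) := by
      field_simp
      ring
    linarith
  have h3 : (1 / α₁ - 1 / α₂) ^ 2 ≤ 0 := by
    by_contra! h
    have := mul_pos (mul_pos hδ hlam) h
    linarith
  have := pow_eq_zero_iff two_ne_zero |>.1 (le_antisymm h3 (sq_nonneg _))
  linarith

end

/-! ### The curve of solutions, parametrized by the threshold -/

/-- The state evolution equation at threshold `α` has a solution `τ > 0`. -/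
def StateSolvable (δ σ : ℝ) (μ : Measure ℝ) (α : ℝ) : Prop :=
  ∃ τ, 0 < τ ∧ stateFun δ σ μ α τ = 1

/-- The solution `τ` of the state evolution equation at threshold `α`. -/
noncomputable def effectiveNoise (δ σ : ℝ) (μ : Measure ℝ) (α : ℝ) : ℝ :=
  Classical.epsilon fun τ => 0 < τ ∧ stateFun δ σ μ α τ = 1

/-- The penalty of which `α` is the threshold. -/
noncomputable def penaltyAt (δ σ : ℝ) (μ : Measure ℝ) (α : ℝ) : ℝ :=
  penalty δ μ α (effectiveNoise δ σ μ α)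

section
variable {δ σ : ℝ} {μ : Measure ℝ} {α : ℝ}

lemma StateSolvable.pos (h : StateSolvable δ σ μ α) : 0 < effectiveNoise δ σ μ α :=
  (Classical.epsilon_spec h).1

lemma StateSolvable.eq_one (h : StateSolvable δ σ μ α) :
    stateFun δ σ μ α (effectiveNoise δ σ μ α) = 1 :=
  (Classical.epsilon_spec h).2

end

section
variable {δ σ : ℝ} {μ : Measure ℝ} [IsProbabilityMeasure μ] {α : ℝ}

lemma stateSolution_eq (hδ : 0 < δ) (hε : 0 < sparsity μ) {lam : ℝ} (hlam : 0 < lam) (hα : 0 < α)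
    (h : StateSolvable δ σ μ α) (hp : penaltyAt δ σ μ α = lam) :
    stateSolution δ σ μ lam = (α, effectiveNoise δ σ μ α) := by
  have hs : IsStateSolution δ σ μ lam (α, effectiveNoise δ σ μ α) :=
    isStateSolution_iff.2 ⟨hα, h.pos, h.eq_one, hp.symm⟩
  exact isStateSolution_unique hδ hε hlam (Classical.epsilon_spec ⟨_, hs⟩) hs

lemma StateSolvable.lt_effectiveNoise (h : StateSolvable δ σ μ α) (hδ : 0 < δ)
    (hε : 0 < sparsity μ) (hα : 0 < α) {t : ℝ} (ht : 0 < t) (h1 : 1 < stateFun δ σ μ α t) :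
    t < effectiveNoise δ σ μ α := by
  rw [← h.eq_one] at h1
  exact ((stateFun_strictAntiOn hδ hε hα).lt_iff_gt h.pos ht).1 h1

lemma StateSolvable.effectiveNoise_lt (h : StateSolvable δ σ μ α) (hδ : 0 < δ)
    (hε : 0 < sparsity μ) (hα : 0 < α) {t : ℝ} (ht : 0 < t) (h1 : stateFun δ σ μ α t < 1) :
    effectiveNoise δ σ μ α < t := by
  rw [← h.eq_one] at h1
  exact ((stateFun_strictAntiOn hδ hε hα).lt_iff_gt ht h.pos).1 h1

lemma tendsto_stateFun {ι : Type*} {l : Filter ι} [l.IsCountablyGenerated] {a t : ι → ℝ}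
    {τ : ℝ} (hα : 0 < α) (hτ : 0 < τ) (ha : Tendsto a l (𝓝 α)) (ht : Tendsto t l (𝓝 τ)) :
    Tendsto (fun i => stateFun δ σ μ (a i) (t i)) l (𝓝 (stateFun δ σ μ α τ)) :=
  (tendsto_const_nhds.div (ht.pow 2) (pow_ne_zero 2 hτ.ne')).add
    ((tendsto_meanRisk_nhds μ hα hτ.ne' ha ht).const_mul _)

lemma continuousOn_stateFun (hα : 0 < α) : ContinuousOn (stateFun δ σ μ α) (Set.Ioi 0) :=
  fun _ hτ => (tendsto_stateFun hα hτ tendsto_const_nhds tendsto_id).mono_left nhdsWithin_le_nhds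

lemma stateSolvable_of_lt_of_lt (hα : 0 < α) {s t : ℝ} (hs : 0 < s) (ht : 0 < t)
    (h1 : 1 < stateFun δ σ μ α s) (h2 : stateFun δ σ μ α t < 1) : StateSolvable δ σ μ α := by
  obtain ⟨τ, hτ, h⟩ := isPreconnected_Ioi.intermediate_value (Set.mem_Ioi.2 ht) (Set.mem_Ioi.2 hs)
    (continuousOn_stateFun (δ := δ) (σ := σ) (μ := μ) hα) ⟨h2.le, h1.le⟩
  exact ⟨τ, hτ, h⟩

/-- The strict inequalities at `s` and `t` persist for nearby thresholds and trap a root between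
them. Openness of solvability and continuity of the noise level both follow. -/
lemma StateSolvable.eventually_between (h : StateSolvable δ σ μ α) (hδ : 0 < δ)
    (hε : 0 < sparsity μ) (hα : 0 < α) {s t : ℝ} (hs : 0 < s)
    (hsα : s < effectiveNoise δ σ μ α) (htα : effectiveNoise δ σ μ α < t) :
    ∀ᶠ a in 𝓝 α, 0 < a ∧ StateSolvable δ σ μ a ∧ s < effectiveNoise δ σ μ a ∧
      effectiveNoise δ σ μ a < t := by
  have ht : 0 < t := h.pos.trans htα
  have h1 : 1 < stateFun δ σ μ α s := by
    rw [← h.eq_one]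
    exact stateFun_strictAntiOn hδ hε hα hs h.pos hsα
  have h2 : stateFun δ σ μ α t < 1 := by
    rw [← h.eq_one]
    exact stateFun_strictAntiOn hδ hε hα h.pos ht htα
  filter_upwards [lt_mem_nhds hα,
    (tendsto_stateFun hα hs tendsto_id tendsto_const_nhds).eventually (lt_mem_nhds h1),
    (tendsto_stateFun hα ht tendsto_id tendsto_const_nhds).eventually (gt_mem_nhds h2)]
    with a ha h1 h2
  have hg := stateSolvable_of_lt_of_lt ha hs ht h1 h2
  exact ⟨ha, hg, hg.lt_effectiveNoise hδ hε ha hs h1, hg.effectiveNoise_lt hδ hε ha ht h2⟩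

lemma StateSolvable.eventually (h : StateSolvable δ σ μ α) (hδ : 0 < δ) (hε : 0 < sparsity μ)
    (hα : 0 < α) : ∀ᶠ a in 𝓝 α, StateSolvable δ σ μ a :=
  (h.eventually_between hδ hε hα (half_pos h.pos) (half_lt_self h.pos) (lt_add_one _)).mono
    fun _ h => h.2.1

lemma StateSolvable.continuousAt_effectiveNoise (h : StateSolvable δ σ μ α) (hδ : 0 < δ)
    (hε : 0 < sparsity μ) (hα : 0 < α) : ContinuousAt (effectiveNoise δ σ μ) α := by
  refine tendsto_order.2 ⟨fun s hs => ?_, fun t ht => ?_⟩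
  · exact (h.eventually_between hδ hε hα (lt_max_of_lt_right (half_pos h.pos))
      (max_lt hs (half_lt_self h.pos)) (lt_add_one _)).mono
      fun _ h => (le_max_left _ _).trans_lt h.2.2.1
  · exact (h.eventually_between hδ hε hα (half_pos h.pos) (half_lt_self h.pos) ht).mono
      fun _ h => h.2.2.2

lemma StateSolvable.tendsto_meanExcess (h : StateSolvable δ σ μ α) (hδ : 0 < δ)
    (hε : 0 < sparsity μ) (hα : 0 < α) (ν : Measure ℝ) [IsProbabilityMeasure ν] :
    Tendsto (fun a => meanExcess ν a (effectiveNoise δ σ μ a)) (𝓝 α)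
      (𝓝 (meanExcess ν α (effectiveNoise δ σ μ α))) :=
  tendsto_meanExcess_nhds ν hα h.pos.ne' tendsto_id (h.continuousAt_effectiveNoise hδ hε hα)

lemma StateSolvable.continuousAt_penaltyAt (h : StateSolvable δ σ μ α) (hδ : 0 < δ)
    (hε : 0 < sparsity μ) (hα : 0 < α) : ContinuousAt (penaltyAt δ σ μ) α :=
  (((h.tendsto_meanExcess hδ hε hα μ).const_mul _).const_sub _).mul
    (tendsto_id.mul (h.continuousAt_effectiveNoise hδ hε hα))

lemma forall_lt_or_forall_gt_of_not_stateSolvable (hα : 0 < α) (h : ¬ StateSolvable δ σ μ α) :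
    (∀ τ, 0 < τ → 1 < stateFun δ σ μ α τ) ∨ ∀ τ, 0 < τ → stateFun δ σ μ α τ < 1 := by
  by_contra! hc
  obtain ⟨⟨t, ht, h2⟩, s, hs, h1⟩ := hc
  have h2 := h2.lt_of_ne fun e => h ⟨t, ht, e⟩
  have h1 := h1.lt_of_ne fun e => h ⟨s, hs, e.symm⟩
  exact h (stateSolvable_of_lt_of_lt hα hs ht h1 h2)

lemma tendsto_stateFun_atTop (hα : 0 < α) :
    Tendsto (stateFun δ σ μ α) atTop (𝓝 (1 / δ * scalarRisk α 0)) := by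
  have h1 : Tendsto (fun τ : ℝ => σ ^ 2 / τ ^ 2) atTop (𝓝 0) :=
    tendsto_const_nhds.div_atTop (tendsto_pow_atTop two_ne_zero)
  have h2 := h1.add ((tendsto_meanRisk_atTop μ hα).const_mul (1 / δ))
  rwa [zero_add] at h2

lemma le_scalarRisk_zero_of_forall_lt (hδ : 0 < δ) (hα : 0 < α)
    (h : ∀ τ, 0 < τ → 1 < stateFun δ σ μ α τ) : δ ≤ scalarRisk α 0 := by
  have := ge_of_tendsto (tendsto_stateFun_atTop (δ := δ) (σ := σ) (μ := μ) hα)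
    ((eventually_gt_atTop 0).mono fun τ hτ => (h τ hτ).le)
  rwa [one_div, inv_mul_eq_div, le_div_iff₀ hδ, one_mul] at this

lemma tendsto_stateFun_zero_nhds_zero (hε : 0 < sparsity μ) (hα : 0 < α) :
    Tendsto (stateFun δ 0 μ α) (𝓝[>] 0) (𝓝 (1 / δ * dtFun (sparsity μ) α)) := by
  refine ((tendsto_meanRisk_nhds_zero hε hα).const_mul (1 / δ)).congr fun τ => ?_
  simp [stateFun]

/-- At `τ = |σ|` the noise term alone already equals `1`. -/
lemma eq_zero_of_forall_stateFun_lt (hδ : 0 < δ) (hα : 0 < α)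
    (h : ∀ τ, 0 < τ → stateFun δ σ μ α τ < 1) : σ = 0 := by
  by_contra hσ
  have h1 := h |σ| (abs_pos.2 hσ)
  have h2 : 0 ≤ 1 / δ * meanRisk μ α |σ| :=
    mul_nonneg (by positivity) ((scalarRisk_nonneg hα.le 0).trans (le_meanRisk μ hα _))
  rw [stateFun, sq_abs, div_self (pow_ne_zero 2 hσ)] at h1
  linarith

lemma dtFun_le_of_forall_stateFun_lt (hδ : 0 < δ) (hε : 0 < sparsity μ) (hα : 0 < α)
    (h : ∀ τ, 0 < τ → stateFun δ 0 μ α τ < 1) : dtFun (sparsity μ) α ≤ δ := by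
  have := le_of_tendsto (tendsto_stateFun_zero_nhds_zero (δ := δ) hε hα)
    (eventually_mem_nhdsWithin.mono fun τ hτ => (h τ hτ).le)
  rwa [one_div, inv_mul_eq_div, div_le_iff₀ hδ, one_mul] at this

lemma StateSolvable.le_dtFun (h : StateSolvable δ 0 μ α) (hδ : 0 < δ) (hε : 0 < sparsity μ)
    (hα : 0 < α) : δ ≤ dtFun (sparsity μ) α := by
  have := ge_of_tendsto (b := 1) (tendsto_stateFun_zero_nhds_zero (δ := δ) hε hα) (by
    filter_upwards [Ioo_mem_nhdsGT h.pos] with τ hτ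
    rw [← h.eq_one]
    exact (stateFun_strictAntiOn hδ hε hα hτ.1 h.pos hτ.2).le)
  rwa [one_div, inv_mul_eq_div, le_div_iff₀ hδ, one_mul] at this

lemma integral_sq_pos (hμ : Integrable (fun x : ℝ => x ^ 2) μ) (hε : 0 < sparsity μ) :
    0 < ∫ x, x ^ 2 ∂μ := by
  rw [integral_pos_iff_support_of_nonneg (fun x => sq_nonneg x) hμ]
  have h : Function.support (fun x : ℝ => x ^ 2) = {0}ᶜ := by ext x; simp
  rw [h]
  exact (measureReal_ne_zero_iff).1 hε.ne' |>.bot_lt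

/-! ### Large thresholds and large penalties -/

/-- For all large thresholds the state evolution equation is solvable, with solutions bounded away
from zero. -/
lemma eventually_stateSolvable (hδ : 0 < δ) (hμ : Integrable (fun x : ℝ => x ^ 2) μ)
    (hε : 0 < sparsity μ) :
    ∃ τ, 0 < τ ∧ ∀ᶠ a in atTop, 0 < a ∧ StateSolvable δ σ μ a ∧ τ < effectiveNoise δ σ μ a := by
  have hm := integral_sq_pos hμ hε
  set m := ∫ x, x ^ 2 ∂μ with hmdef
  -- Chosen so that `𝔼 (X / τ) ^ 2 = 2 δ`. For large `a` nothing is selected in the limit, so the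
  -- risk at `τ` exceeds `δ` and the root lies above `τ`.
  set τ := √(m / (2 * δ)) with hτdef
  have hτ : 0 < τ := Real.sqrt_pos.2 (by positivity)
  have hτ2 : τ ^ 2 = m / (2 * δ) := Real.sq_sqrt (by positivity)
  refine ⟨τ, hτ, ?_⟩
  have hint : Integrable (fun x : ℝ => (x / τ) ^ 2) μ := by
    simpa only [div_pow] using hμ.div_const (τ ^ 2)
  have hexc : ∀ x, Tendsto (fun a => excess a (x / τ)) atTop (𝓝 0) := fun x => by
    refine squeeze_zero' (Eventually.of_forall fun a => excess_nonneg _ _)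
      ((eventually_gt_atTop 0).mono fun a ha => excess_le_div_sq ha _) ?_
    exact tendsto_const_nhds.div_atTop (tendsto_pow_atTop two_ne_zero)
  have hlim : Tendsto (fun a => ∫ x, (x / τ) ^ 2 * (1 - excess a (x / τ)) ∂μ) atTop
      (𝓝 (∫ x, (x / τ) ^ 2 ∂μ)) := by
    refine tendsto_integral_filter_of_dominated_convergence (fun x => (x / τ) ^ 2)
      (Eventually.of_forall fun a => ?_) ?_ hint (ae_of_all _ fun x => ?_)
    · have := continuous_excess_div a τ
      exact (by fun_prop : Continuous fun x => (x / τ) ^ 2 * (1 - excess a (x / τ))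
        ).aestronglyMeasurable
    · filter_upwards [eventually_ge_atTop 0] with a ha
      refine ae_of_all _ fun x => ?_
      have h1 := excess_le_one ha (x / τ)
      have h2 := excess_nonneg a (x / τ)
      rw [Real.norm_of_nonneg (mul_nonneg (sq_nonneg _) (by linarith))]
      exact mul_le_of_le_one_right (sq_nonneg _) (by linarith)
    · simpa using ((hexc x).const_sub 1).const_mul ((x / τ) ^ 2)
  have hval : ∫ x, (x / τ) ^ 2 ∂μ = 2 * δ := by
    simp only [div_pow]
    rw [integral_div, hτ2, ← hmdef]
    field_simp
  rw [hval] at hlim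
  have hr0 : Tendsto (fun a => scalarRisk a 0) atTop (𝓝 0) :=
    squeeze_zero' ((eventually_ge_atTop 0).mono fun a ha => scalarRisk_nonneg ha 0)
      ((eventually_gt_atTop 0).mono fun a ha => (scalarRisk_zero_lt_div_sq ha).le)
      (tendsto_const_nhds.div_atTop (tendsto_pow_atTop two_ne_zero))
  filter_upwards [eventually_gt_atTop 0, hlim.eventually (lt_mem_nhds (by linarith : δ < 2 * δ)),
    hr0.eventually (gt_mem_nhds hδ)] with a ha h1 h2
  have g1 : 1 < stateFun δ σ μ a τ := by
    have h3 : δ < meanRisk μ a τ := by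
      refine h1.trans_le (integral_mono_of_nonneg (ae_of_all _ fun x => ?_)
        (integrable_scalarRisk_div μ ha τ) (ae_of_all _ fun x => sq_mul_le_scalarRisk ha.le _))
      exact mul_nonneg (sq_nonneg _) (by linarith [excess_le_one ha.le (x / τ)])
    have h4 : 1 < 1 / δ * meanRisk μ a τ := by
      rwa [one_div, inv_mul_eq_div, one_lt_div hδ]
    have : 0 ≤ σ ^ 2 / τ ^ 2 := by positivity
    rw [stateFun]
    linarith
  have h3 : 1 / δ * scalarRisk a 0 < 1 := by
    rwa [one_div, inv_mul_eq_div, div_lt_one hδ]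
  obtain ⟨t, ht, g2⟩ := ((eventually_gt_atTop 0).and
    ((tendsto_stateFun_atTop (δ := δ) (σ := σ) (μ := μ) ha).eventually (gt_mem_nhds h3))).exists
  have hg := stateSolvable_of_lt_of_lt ha hτ ht g1 g2
  exact ⟨ha, hg, hg.lt_effectiveNoise hδ hε ha hτ g1⟩

/-- The selection probability eventually falls below `δ / 2`, and then the penalty is at least half
of `a τ`, with `τ` the fixed lower bound for the noise level. -/
lemma tendsto_penaltyAt_atTop (hδ : 0 < δ) (hμ : Integrable (fun x : ℝ => x ^ 2) μ)
    (hε : 0 < sparsity μ) : Tendsto (penaltyAt δ σ μ) atTop atTop := by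
  obtain ⟨τ, hτ, h⟩ := eventually_stateSolvable (σ := σ) hδ hμ hε
  have hb : Tendsto (fun a : ℝ => (1 + (∫ x, x ^ 2 ∂μ) / τ ^ 2) / a ^ 2) atTop (𝓝 0) :=
    tendsto_const_nhds.div_atTop (tendsto_pow_atTop two_ne_zero)
  refine tendsto_atTop_mono' atTop ?_ (tendsto_id.const_mul_atTop (half_pos hτ))
  filter_upwards [h, hb.eventually (gt_mem_nhds (half_pos hδ))] with a ⟨ha, _, ht⟩ hba
  have hm : 0 ≤ ∫ x, x ^ 2 ∂μ := integral_nonneg fun x => sq_nonneg x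
  have h1 : meanExcess μ a (effectiveNoise δ σ μ a) ≤ δ / 2 := by
    refine (meanExcess_le_div_sq μ hμ ha _).trans (le_trans ?_ hba.le)
    gcongr
  have h2 : 1 / 2 ≤ 1 - 1 / δ * meanExcess μ a (effectiveNoise δ σ μ a) := by
    have : 1 / δ * meanExcess μ a (effectiveNoise δ σ μ a) ≤ 1 / δ * (δ / 2) := by gcongr
    have e : 1 / δ * (δ / 2) = 1 / 2 := by field_simp
    linarith
  have h3 : a * τ ≤ a * effectiveNoise δ σ μ a := by gcongr
  have h4 : 0 ≤ a * τ := by positivity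
  rw [penaltyAt, penalty, id]
  nlinarith

/-- Limits along the curve of solutions, parametrized by the threshold, carry over to limits in the
penalty. -/
lemma tendsto_comp_stateSolution (hδ : 0 < δ) (hε : 0 < sparsity μ) {X : Type*} {lX : Filter X}
    {l k : Filter ℝ} {F : ℝ × ℝ → X}
    (h : ∀ s ∈ k, ∀ᶠ lam in l, 0 < lam ∧ ∃ a ∈ s, 0 < a ∧ StateSolvable δ σ μ a ∧
      penaltyAt δ σ μ a = lam)
    (hF : Tendsto (fun a => F (a, effectiveNoise δ σ μ a)) k lX) :
    Tendsto (fun lam => F (stateSolution δ σ μ lam)) l lX := by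
  refine tendsto_def.2 fun U hU => ?_
  filter_upwards [h _ (tendsto_def.1 hF U hU)] with lam ⟨hlam, a, has, ha, hg, hp⟩
  rw [Set.mem_preimage, stateSolution_eq hδ hε hlam ha hg hp]
  exact has

lemma tendsto_tppInf_atTop (hδ : 0 < δ) (hμ : Integrable (fun x : ℝ => x ^ 2) μ)
    (hε : 0 < sparsity μ) : Tendsto (tppInf δ σ μ) atTop (𝓝 0) := by
  have hν := isProbabilityMeasure_nonzeroPart hε
  obtain ⟨τ, hτ, h⟩ := eventually_stateSolvable (σ := σ) hδ hμ hε
  have hpen := tendsto_penaltyAt_atTop (σ := σ) hδ hμ hε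
  refine tendsto_comp_stateSolution (k := atTop)
    (F := fun p => selectionProb (nonzeroPart μ) p.1 p.2) hδ hε (fun s hs => ?_) ?_
  · obtain ⟨A, hA⟩ := ((eventually_mem_set.2 hs).and h).exists_forall_of_atTop
    have hc : ContinuousOn (penaltyAt δ σ μ) (Set.Ici A) := fun a ha =>
      ((hA a ha).2.2.1.continuousAt_penaltyAt hδ hε (hA a ha).2.1).continuousWithinAt
    have hiv := isPreconnected_Ici.intermediate_value_Ici (Set.self_mem_Ici (a := A))
      (le_principal_iff.2 (Ici_mem_atTop A)) hc hpen
    filter_upwards [eventually_gt_atTop 0, eventually_ge_atTop (penaltyAt δ σ μ A)] with lam h0 h1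
    obtain ⟨a, ha, hp⟩ := hiv h1
    exact ⟨h0, a, (hA a ha).1, (hA a ha).2.1, (hA a ha).2.2.1, hp⟩
  · have hb : Tendsto (fun a : ℝ => (1 + (∫ x, x ^ 2 ∂μ) / τ ^ 2) / a ^ 2 / sparsity μ) atTop
        (𝓝 0) := by
      simpa using (tendsto_const_nhds.div_atTop
        (tendsto_pow_atTop (α := ℝ) two_ne_zero)).div_const (sparsity μ)
    refine squeeze_zero' ?_ ?_ hb
    · exact Eventually.of_forall fun a => measureReal_nonneg
    · filter_upwards [h] with a ⟨ha, hg, ht⟩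
      have hm : 0 ≤ ∫ x, x ^ 2 ∂μ := integral_nonneg fun x => sq_nonneg x
      rw [selectionProb_eq _ ha.le hg.pos, le_div_iff₀ hε, mul_comm]
      have h1 := meanExcess_le_div_sq μ hμ ha (effectiveNoise δ σ μ a)
      rw [meanExcess_eq_sparsity hε ha.le] at h1
      have h2 : 0 ≤ 2 * (1 - sparsity μ) * Phi (-a) :=
        mul_nonneg (by linarith [sparsity_le_one (μ := μ)]) (Phi_nonneg _)
      have h3 : (1 + (∫ x, x ^ 2 ∂μ) / effectiveNoise δ σ μ a ^ 2) / a ^ 2 ≤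
          (1 + (∫ x, x ^ 2 ∂μ) / τ ^ 2) / a ^ 2 := by gcongr
      linarith

end

/-! ### The critical threshold and the limit of vanishing penalty -/

lemma meanExcess_lt_of_penaltyAt_pos {δ σ : ℝ} {μ : Measure ℝ} (hδ : 0 < δ) {a : ℝ}
    (ha : 0 < a)
    (h : StateSolvable δ σ μ a) (hp : 0 < penaltyAt δ σ μ a) :
    meanExcess μ a (effectiveNoise δ σ μ a) < δ := by
  have h1 := (mul_pos_iff_of_pos_right (mul_pos ha h.pos)).1 hp
  rwa [sub_pos, one_div, inv_mul_eq_div, div_lt_one hδ] at h1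

section
variable {δ σ : ℝ} {μ : Measure ℝ} [IsProbabilityMeasure μ]

/-- There is a least `c ≥ 0` beyond which all thresholds carry a positive penalty. -/
lemma exists_critical_threshold (hδ : 0 < δ) (hμ : Integrable (fun x : ℝ => x ^ 2) μ)
    (hε : 0 < sparsity μ) :
    ∃ c, 0 ≤ c ∧ (∀ a, c < a → StateSolvable δ σ μ a ∧ 0 < penaltyAt δ σ μ a) ∧
      (c = 0 ∨ 0 < c ∧ ¬ (StateSolvable δ σ μ c ∧ 0 < penaltyAt δ σ μ c)) := by
  -- Including `0` makes the set nonempty, so that its supremum is a true, nonnegative supremum.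
  let bad : Set ℝ := {a | a = 0 ∨ 0 < a ∧ ¬ (StateSolvable δ σ μ a ∧ 0 < penaltyAt δ σ μ a)}
  obtain ⟨τ, -, h⟩ := eventually_stateSolvable (σ := σ) hδ hμ hε
  obtain ⟨A, hA⟩ := (h.and ((tendsto_penaltyAt_atTop (σ := σ) hδ hμ
    hε).eventually_gt_atTop 0)).exists_forall_of_atTop
  have hbdd : BddAbove bad := by
    refine ⟨A, fun a ha => ?_⟩
    by_contra! hlt
    obtain ⟨⟨h0, hs, -⟩, hp⟩ := hA a hlt.le
    rcases ha with ha | ha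
    · exact h0.ne' ha
    · exact ha.2 ⟨hs, hp⟩
  have h0 : (0 : ℝ) ∈ bad := Or.inl rfl
  have hc0 : 0 ≤ sSup bad := le_csSup hbdd h0
  refine ⟨sSup bad, hc0, fun a ha => ?_, ?_⟩
  · by_contra hn
    exact ha.not_ge (le_csSup hbdd (Or.inr ⟨hc0.trans_lt ha, hn⟩))
  · rcases hc0.eq_or_lt with hc | hc
    · exact Or.inl hc.symm
    · refine Or.inr ⟨hc, fun ⟨hs, hp⟩ => ?_⟩
      have hev : ∀ᶠ a in 𝓝 (sSup bad), a ∉ bad := by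
        filter_upwards [lt_mem_nhds hc, hs.eventually hδ hε hc,
          (hs.continuousAt_penaltyAt hδ hε hc).eventually (lt_mem_nhds hp)] with a h1 h2 h3 hb
        rcases hb with hb | hb
        · exact h1.ne' hb
        · exact hb.2 ⟨h2, h3⟩
      -- A least upper bound is approached by elements of its set, whereas a good positive supremum
      -- would have a neighbourhood of good thresholds.
      exact (isLUB_csSup ⟨0, h0⟩ hbdd).frequently_mem ⟨0, h0⟩ (hev.filter_mono nhdsWithin_le_nhds)

/-- The limiting proportions as a function of `(α, τ)`. -/
noncomputable def proportions (μ : Measure ℝ) (p : ℝ × ℝ) : ℝ × ℝ :=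
  (selectionProb (nonzeroPart μ) p.1 p.2, 2 * (1 - sparsity μ) * Phi (-p.1) /
    (2 * (1 - sparsity μ) * Phi (-p.1) + sparsity μ * selectionProb (nonzeroPart μ) p.1 p.2))

/-- The limit of the proportions as the threshold decreases to `c`, in terms of that of the
true positive proportion. -/
lemma tendsto_proportions (hε : 0 < sparsity μ) {c x : ℝ} (hc : 0 ≤ c)
    (hs : ∀ a, c < a → StateSolvable δ σ μ a)
    (hx : Tendsto (fun a => meanExcess (nonzeroPart μ) a (effectiveNoise δ σ μ a)) (𝓝[>] c) (𝓝 x))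
    (h0 : 2 * (1 - sparsity μ) * Phi (-c) + sparsity μ * x ≠ 0) :
    Tendsto (fun a => proportions μ (a, effectiveNoise δ σ μ a)) (𝓝[>] c)
      (𝓝 (x, 2 * (1 - sparsity μ) * Phi (-c) /
        (2 * (1 - sparsity μ) * Phi (-c) + sparsity μ * x))) := by
  have := isProbabilityMeasure_nonzeroPart hε
  have hx' : Tendsto (fun a => selectionProb (nonzeroPart μ) a (effectiveNoise δ σ μ a)) (𝓝[>] c)
      (𝓝 x) := hx.congr' <| by
    filter_upwards [self_mem_nhdsWithin] with a ha
    exact (selectionProb_eq _ (hc.trans (Set.mem_Ioi.1 ha).le) (hs a ha).pos).symm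
  have hP : Tendsto (fun a => 2 * (1 - sparsity μ) * Phi (-a)) (𝓝[>] c)
      (𝓝 (2 * (1 - sparsity μ) * Phi (-c))) :=
    (((continuous_Phi.comp continuous_neg).tendsto c).const_mul _).mono_left nhdsWithin_le_nhds
  exact hx'.prodMk_nhds (hP.div (hP.add (hx'.const_mul _)) h0)

/-- On `(c, A]` the penalty is continuous, positive, and tends to `0` at the left end. Every small
penalty is therefore attained at a threshold as close to `c` as desired. -/
lemma tendsto_proportions_stateSolution (hδ : 0 < δ) (hε : 0 < sparsity μ) {c : ℝ} (hc : 0 ≤ c)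
    (h : ∀ a, c < a → StateSolvable δ σ μ a ∧ 0 < penaltyAt δ σ μ a)
    (hp : Tendsto (penaltyAt δ σ μ) (𝓝[>] c) (𝓝 0)) {L : ℝ × ℝ}
    (hL : Tendsto (fun a => proportions μ (a, effectiveNoise δ σ μ a)) (𝓝[>] c) (𝓝 L)) :
    Tendsto (fun lam => (tppInf δ σ μ lam, fdpInf δ σ μ lam)) (𝓝[>] 0) (𝓝 L) := by
  refine tendsto_comp_stateSolution (F := proportions μ) hδ hε (fun s hs => ?_) hL
  obtain ⟨A, hA, hsub⟩ := (mem_nhdsGT_iff_exists_Ioc_subset).1 hs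
  have hA : c < A := hA
  have hcont : ContinuousOn (penaltyAt δ σ μ) (Set.Ioc c A) := fun a ha =>
    ((h a ha.1).1.continuousAt_penaltyAt hδ hε (hc.trans_lt ha.1)).continuousWithinAt
  have hiv := isPreconnected_Ioc.intermediate_value_Ioc (Set.right_mem_Ioc.2 hA)
    (le_principal_iff.2 (Ioc_mem_nhdsGT hA)) hcont hp
  filter_upwards [Ioc_mem_nhdsGT (h A hA).2] with lam hlam
  obtain ⟨a, ha, e⟩ := hiv hlam
  exact ⟨hlam.1, a, hsub ha, hc.trans_lt ha.1, (h a ha.1).1, e⟩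

lemma penaltyAt_le (hδ : 0 < δ) {a : ℝ} (ha : 0 < a) (h : StateSolvable δ σ μ a) :
    penaltyAt δ σ μ a ≤ a * effectiveNoise δ σ μ a := by
  have h1 := meanExcess_nonneg μ ha.le (effectiveNoise δ σ μ a)
  have h2 : 0 ≤ 1 / δ * meanExcess μ a (effectiveNoise δ σ μ a) := by positivity
  exact mul_le_of_le_one_left (mul_pos ha h.pos).le (by linarith)

lemma tendsto_meanExcess_one (ν : Measure ℝ) [IsProbabilityMeasure ν] (t : ℝ → ℝ) :
    Tendsto (fun a => meanExcess ν a (t a)) (𝓝[>] 0) (𝓝 1) := by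
  have h1 : Tendsto (fun a : ℝ => 1 - a) (𝓝[>] 0) (𝓝 1) :=
    ((by fun_prop : Continuous fun a : ℝ => 1 - a).tendsto' 0 1 (by simp)).mono_left
      nhdsWithin_le_nhds
  refine tendsto_of_tendsto_of_tendsto_of_le_of_le' h1 tendsto_const_nhds ?_ ?_
  · filter_upwards [self_mem_nhdsWithin] with a ha
    exact le_meanExcess ν (Set.mem_Ioi.1 ha).le fun u => one_sub_le_excess (Set.mem_Ioi.1 ha).le u
  · filter_upwards [self_mem_nhdsWithin] with a ha
    exact meanExcess_le_one ν (Set.mem_Ioi.1 ha).le _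

/-- At `δ = 1` the penalty vanishes as the threshold decreases to zero. -/
lemma tendsto_penaltyAt_zero_of_eq_one (hμ : Integrable (fun x : ℝ => x ^ 2) μ)
    (h : ∀ a, 0 < a → StateSolvable 1 σ μ a ∧ 0 < penaltyAt 1 σ μ a) :
    Tendsto (penaltyAt 1 σ μ) (𝓝[>] 0) (𝓝 0) := by
  set M := σ ^ 2 + ∫ x, x ^ 2 ∂μ with hM
  set k := 1 - scalarRisk 1 0 with hk
  have hk0 : 0 < k := by
    have := strictAnti_scalarRisk_zero zero_lt_one
    simp only [scalarRisk_zero_zero] at this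
    linarith
  have hb : Tendsto (fun a : ℝ => a * ((1 + a * M / k) / 2)) (𝓝[>] 0) (𝓝 0) :=
    ((by fun_prop : Continuous fun a : ℝ => a * ((1 + a * M / k) / 2)).tendsto' 0 0
      (by simp)).mono_left nhdsWithin_le_nhds
  refine squeeze_zero' (eventually_mem_nhdsWithin.mono fun a ha => (h a ha).2.le) ?_ hb
  filter_upwards [Ioc_mem_nhdsGT zero_lt_one] with a ⟨ha0, ha1⟩
  obtain ⟨hs, -⟩ := h a ha0
  set τ := effectiveNoise 1 σ μ a with hτdef
  have hτ : 0 < τ := hs.pos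
  -- Here the noise level may blow up as `a ↓ 0`. Convexity of the risk at zero signal makes it fall
  -- linearly below `1`, which limits the growth to `τ ^ 2 = O(1 / a)`.
  have hr : scalarRisk a 0 ≤ 1 - a * k := by
    have h1 := convexOn_scalarRisk_zero.2 (Set.mem_univ 0) (Set.mem_univ 1)
      (by linarith : (0 : ℝ) ≤ 1 - a) ha0.le (by ring)
    simp only [smul_eq_mul, mul_zero, mul_one, zero_add, scalarRisk_zero_zero] at h1
    linarith
  have h2 : τ ^ 2 * (a * k) ≤ M := by
    have h1 := hs.eq_one
    rw [stateFun, ← hτdef] at h1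
    have h3 := meanRisk_le_add μ hμ ha0 τ
    have h4 : a * k ≤ M / τ ^ 2 := by
      rw [hM, add_div]
      linarith
    rwa [le_div_iff₀ (by positivity), mul_comm] at h4
  have h5 : (a * τ) ^ 2 ≤ a * M / k := by
    rw [le_div_iff₀ hk0]
    nlinarith
  -- A crude bound suffices, because `1 - meanExcess` supplies another factor `a`.
  have h6 : a * τ ≤ (1 + a * M / k) / 2 := by
    nlinarith [sq_nonneg (a * τ - 1)]
  have h7 : 1 - a ≤ meanExcess μ a τ := le_meanExcess μ ha0.le fun u => one_sub_le_excess ha0.le u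
  have h8 : 0 ≤ a * τ := by positivity
  calc penaltyAt 1 σ μ a = (1 - meanExcess μ a τ) * (a * τ) := by
        rw [penaltyAt, penalty, ← hτdef]; ring
    _ ≤ a * (a * τ) := by gcongr; linarith
    _ ≤ _ := by gcongr

/-- For `δ > 1` the noise level stays bounded as `a ↓ 0`: the risk is at most `1 + a ^ 2`, so one
fixed `t` has `stateFun` below `1` for all small `a`. -/
lemma tendsto_penaltyAt_zero_of_one_lt (hδ : 1 < δ) (hε : 0 < sparsity μ)
    (h : ∀ a, 0 < a → StateSolvable δ σ μ a ∧ 0 < penaltyAt δ σ μ a) :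
    Tendsto (penaltyAt δ σ μ) (𝓝[>] 0) (𝓝 0) := by
  have hδ0 : 0 < δ := by linarith
  have hinv : 1 / δ < 1 := by rwa [div_lt_one hδ0]
  have hσ2 : Tendsto (fun τ : ℝ => σ ^ 2 / τ ^ 2 + 1 / δ) atTop (𝓝 (0 + 1 / δ)) :=
    (tendsto_const_nhds.div_atTop (tendsto_pow_atTop two_ne_zero)).add_const _
  rw [zero_add] at hσ2
  obtain ⟨t, ht, hlt⟩ := ((eventually_gt_atTop 0).and (hσ2.eventually (gt_mem_nhds hinv))).exists
  have hlim : Tendsto (fun a : ℝ => σ ^ 2 / t ^ 2 + 1 / δ * (1 + a ^ 2)) (𝓝[>] 0)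
      (𝓝 (σ ^ 2 / t ^ 2 + 1 / δ)) :=
    ((by fun_prop : Continuous fun a : ℝ => σ ^ 2 / t ^ 2 + 1 / δ * (1 + a ^ 2)).tendsto' 0 _
      (by simp)).mono_left nhdsWithin_le_nhds
  have hb : Tendsto (fun a : ℝ => a * t) (𝓝[>] 0) (𝓝 0) :=
    ((by fun_prop : Continuous fun a : ℝ => a * t).tendsto' 0 0 (by simp)).mono_left
      nhdsWithin_le_nhds
  refine squeeze_zero' (eventually_mem_nhdsWithin.mono fun a ha => (h a ha).2.le) ?_ hb
  filter_upwards [self_mem_nhdsWithin, hlim.eventually (gt_mem_nhds hlt)] with a ha h1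
  have ha : 0 < a := ha
  have h2 : stateFun δ σ μ a t < 1 := by
    refine lt_of_le_of_lt ?_ h1
    rw [stateFun]
    have := meanRisk_le_one_add_sq μ ha t
    gcongr
  have h3 := (h a ha).1.effectiveNoise_lt hδ0 hε ha ht h2
  exact (penaltyAt_le hδ0 ha (h a ha).1).trans (by gcongr)

lemma one_le_of_penaltyAt_pos (hδ : 0 < δ)
    (h : ∀ a, 0 < a → StateSolvable δ σ μ a ∧ 0 < penaltyAt δ σ μ a) : 1 ≤ δ := by
  refine le_of_forall_pos_sub_le fun a ha => ?_
  have h1 := meanExcess_lt_of_penaltyAt_pos hδ ha (h a ha).1 (h a ha).2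
  exact (le_meanExcess μ ha.le fun u => one_sub_le_excess ha.le u).trans h1.le

lemma tendsto_penaltyAt_zero (hδ : 0 < δ) (hμ : Integrable (fun x : ℝ => x ^ 2) μ)
    (hε : 0 < sparsity μ)
    (h : ∀ a, 0 < a → StateSolvable δ σ μ a ∧ 0 < penaltyAt δ σ μ a) :
    Tendsto (penaltyAt δ σ μ) (𝓝[>] 0) (𝓝 0) := by
  rcases (one_le_of_penaltyAt_pos hδ h).eq_or_lt with h1 | h1
  · subst h1
    exact tendsto_penaltyAt_zero_of_eq_one hμ h
  · exact tendsto_penaltyAt_zero_of_one_lt h1 hε h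

/-- The alternative, `stateFun` above `1` throughout, would give `δ ≤ scalarRisk c 0 < excess c 0`.
But positive penalties beyond `c` keep the selection probability, and with it `excess c 0` in the
limit, at most `δ`. -/
lemma forall_stateFun_lt_of_penaltyAt_pos (hδ : 0 < δ) {c : ℝ} (hc : 0 < c)
    (hns : ¬ StateSolvable δ σ μ c)
    (h : ∀ a, c < a → StateSolvable δ σ μ a ∧ 0 < penaltyAt δ σ μ a) :
    ∀ τ, 0 < τ → stateFun δ σ μ c τ < 1 := by
  refine (forall_lt_or_forall_gt_of_not_stateSolvable hc hns).resolve_left fun hgt => ?_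
  have h1 := (le_scalarRisk_zero_of_forall_lt hδ hc hgt).trans_lt (scalarRisk_zero_lt_excess hc)
  have h2 : Tendsto (fun a => excess a 0) (𝓝[>] c) (𝓝 (excess c 0)) :=
    (tendsto_excess tendsto_id tendsto_const_nhds).mono_left nhdsWithin_le_nhds
  refine h1.not_ge (le_of_tendsto h2 (eventually_mem_nhdsWithin.mono fun a ha => ?_))
  have ha : c < a := ha
  have ha0 := hc.trans ha
  exact (le_meanExcess μ ha0.le fun u => excess_zero_le ha0.le u).trans
    (meanExcess_lt_of_penaltyAt_pos hδ ha0 (h a ha).1 (h a ha).2).le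

lemma tendsto_effectiveNoise_zero (hδ : 0 < δ) (hε : 0 < sparsity μ) {c : ℝ} (hc : 0 < c)
    (hs : ∀ a, c < a → StateSolvable δ σ μ a) (hlt : ∀ τ, 0 < τ → stateFun δ σ μ c τ < 1) :
    Tendsto (effectiveNoise δ σ μ) (𝓝[>] c) (𝓝[>] 0) := by
  refine tendsto_nhdsWithin_iff.2
    ⟨tendsto_order.2 ⟨fun s hs0 => ?_, fun t ht => ?_⟩,
      eventually_mem_nhdsWithin.mono fun a ha => (hs a ha).pos⟩
  · exact eventually_mem_nhdsWithin.mono fun a ha => hs0.trans (hs a ha).pos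
  · have h1 := (tendsto_stateFun (δ := δ) (σ := σ) (μ := μ) hc ht tendsto_id
      tendsto_const_nhds).eventually (gt_mem_nhds (hlt t ht))
    filter_upwards [self_mem_nhdsWithin, h1.filter_mono nhdsWithin_le_nhds] with a ha h2
    exact (hs a ha).effectiveNoise_lt hδ hε (hc.trans ha) ht h2

/-- As the penalty decreases to zero, the limit of the proportions exists. The threshold converges
either to a point where the penalty vanishes, or, in the absence of noise, to a point where the
state evolution degenerates, or to zero. -/
theorem exists_tendsto_proportions (hδ : 0 < δ) (hμ : Integrable (fun x : ℝ => x ^ 2) μ)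
    (hε : 0 < sparsity μ) :
    ∃ c x, Tendsto (fun lam => (tppInf δ σ μ lam, fdpInf δ σ μ lam)) (𝓝[>] 0)
      (𝓝 (x, 2 * (1 - sparsity μ) * Phi (-c) /
        (2 * (1 - sparsity μ) * Phi (-c) + sparsity μ * x))) ∧
      ((0 ≤ x ∧ x ≤ 1 ∧ 2 * (1 - sparsity μ) * Phi (-c) + sparsity μ * x = δ ∧ δ ≤ 1) ∨
      (0 < c ∧ x = 1 ∧ dtFun (sparsity μ) c = δ ∧
        2 * (1 - sparsity μ) * Phi (-c) + sparsity μ ≤ δ) ∨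
      (c = 0 ∧ x = 1 ∧ 1 ≤ δ)) := by
  have hν := isProbabilityMeasure_nonzeroPart hε
  have hε1 : 0 ≤ 1 - sparsity μ := by linarith [sparsity_le_one (μ := μ)]
  obtain ⟨c, hc0, h, hc⟩ := exists_critical_threshold (σ := σ) hδ hμ hε
  have hs := fun a ha => (h a ha).1
  have hden : 0 < 2 * (1 - sparsity μ) * Phi (-c) + sparsity μ * 1 := by
    have := Phi_nonneg (-c)
    positivity
  -- Three cases: `c = 0`, then `c > 0` with the state evolution equation solvable at `c`, then `c >
  -- 0` with no solution.
  rcases hc with rfl | ⟨hc, hn⟩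
  · exact ⟨0, 1, tendsto_proportions_stateSolution hδ hε le_rfl h
      (tendsto_penaltyAt_zero hδ hμ hε h)
      (tendsto_proportions hε le_rfl hs (tendsto_meanExcess_one _ _) hden.ne'),
      Or.inr (Or.inr ⟨rfl, rfl, one_le_of_penaltyAt_pos hδ h⟩)⟩
  by_cases hsc : StateSolvable δ σ μ c
  · have hp := (hsc.continuousAt_penaltyAt hδ hε hc).tendsto.mono_left
      (nhdsWithin_le_nhds (s := Set.Ioi c))
    have hp0 : penaltyAt δ σ μ c = 0 :=
      le_antisymm (not_lt.1 fun hpos => hn ⟨hsc, hpos⟩)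
        (ge_of_tendsto hp (eventually_mem_nhdsWithin.mono fun a ha => (h a ha).2.le))
    rw [hp0] at hp
    have he : meanExcess μ c (effectiveNoise δ σ μ c) = δ := by
      rw [penaltyAt, penalty, mul_eq_zero, or_iff_left (mul_pos hc hsc.pos).ne', sub_eq_zero] at hp0
      field_simp at hp0
      exact hp0.symm
    have hle := meanExcess_le_one μ hc.le (effectiveNoise δ σ μ c)
    rw [he] at hle
    rw [meanExcess_eq_sparsity hε hc.le] at he
    refine ⟨c, _, tendsto_proportions_stateSolution hδ hε hc.le h hp (tendsto_proportions hε hc.le hs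
      ((hsc.tendsto_meanExcess hδ hε hc (nonzeroPart μ)).mono_left nhdsWithin_le_nhds) ?_),
      Or.inl ⟨meanExcess_nonneg _ hc.le _, meanExcess_le_one _ hc.le _, he, hle⟩⟩
    rw [he]
    exact hδ.ne'
  · have hlt := forall_stateFun_lt_of_penaltyAt_pos hδ hc hsc h
    have hσ := eq_zero_of_forall_stateFun_lt hδ hc hlt
    subst hσ
    have hτ := tendsto_effectiveNoise_zero hδ hε hc hs hlt
    have hid : Tendsto (fun a : ℝ => a) (𝓝[>] c) (𝓝 c) := nhdsWithin_le_nhds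
    have hpos : ∀ᶠ a in 𝓝[>] c, 0 ≤ a := eventually_mem_nhdsWithin.mono fun a ha => (hc.trans ha).le
    have hx := tendsto_meanExcess_nonzeroPart hε hid hpos hτ
    have hp : Tendsto (penaltyAt δ 0 μ) (𝓝[>] c) (𝓝 0) := by
      have hb := hid.mul (tendsto_nhds_of_tendsto_nhdsWithin hτ)
      rw [mul_zero] at hb
      exact squeeze_zero' (eventually_mem_nhdsWithin.mono fun a ha => (h a ha).2.le)
        (eventually_mem_nhdsWithin.mono fun a ha => penaltyAt_le hδ (hc.trans ha) (hs a ha)) hb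
    refine ⟨c, 1, tendsto_proportions_stateSolution hδ hε hc.le h hp
      (tendsto_proportions hε hc.le hs hx hden.ne'), Or.inr (Or.inl ⟨hc, rfl, ?_, ?_⟩)⟩
    -- Absence of a root at `c` gives one inequality; existence of roots at all `a > c` gives the
    -- other by continuity.
    · refine le_antisymm (dtFun_le_of_forall_stateFun_lt hδ hε hc hlt) ?_
      have hd := ((hasDerivAt_dtFun (sparsity μ) c).continuousAt.tendsto.mono_left
        (nhdsWithin_le_nhds (s := Set.Ioi c)))
      exact ge_of_tendsto hd (eventually_mem_nhdsWithin.mono fun a ha =>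
        (hs a ha).le_dtFun hδ hε (hc.trans ha))
    · have hP : Tendsto (fun a => 2 * (1 - sparsity μ) * Phi (-a)) (𝓝[>] c)
        (𝓝 (2 * (1 - sparsity μ) * Phi (-c))) :=
        (((continuous_Phi.comp continuous_neg).tendsto c).const_mul _).mono_left nhdsWithin_le_nhds
      have hl := hP.add (hx.const_mul (sparsity μ))
      rw [mul_one] at hl
      refine le_of_tendsto hl (eventually_mem_nhdsWithin.mono fun a ha => ?_)
      have ha0 : 0 < a := hc.trans ha
      rw [← meanExcess_eq_sparsity hε ha0.le]
      exact (meanExcess_lt_of_penaltyAt_pos hδ ha0 (h a ha).1 (h a ha).2).le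

end

/-! ### The phase transition -/

lemma continuous_dtFun (e : ℝ) : Continuous (dtFun e) :=
  continuous_iff_continuousAt.2 fun t => (hasDerivAt_dtFun e t).continuousAt

lemma dtFun_zero (e : ℝ) : dtFun e 0 = 1 := by
  rw [dtFun_eq, scalarRisk_zero_zero]; ring

lemma dtFun_sub_dtFun (e e' t : ℝ) :
    dtFun e' t - dtFun e t = (e' - e) * (1 + t ^ 2 - scalarRisk t 0) := by
  rw [dtFun_eq, dtFun_eq]; ring

lemma one_add_sq_sub_scalarRisk_pos {t : ℝ} (ht : 0 < t) : 0 < 1 + t ^ 2 - scalarRisk t 0 := by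
  have := scalarRisk_zero_le_one ht.le
  have : 0 < t ^ 2 := by positivity
  linarith

lemma continuous_scalarRisk_zero : Continuous fun t => scalarRisk t 0 :=
  continuous_scalarRisk.comp (f := fun t => (t, 0)) (by fun_prop)

/-- For `0 < δ < 1` the sparsity at which `dtFun e` touches the level `δ` from above is a phase
transition point. -/
lemma exists_isPhaseTransition {δ : ℝ} (hδ : 0 < δ) (hδ1 : δ < 1) : ∃ e, IsPhaseTransition δ e := by
  -- Since `dtFun e t` is affine in `e`, `h t` is the sparsity at which it equals `δ`. The
  -- transition point is the maximum of `h`.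
  let h : ℝ → ℝ := fun t => (δ - scalarRisk t 0) / (1 + t ^ 2 - scalarRisk t 0)
  have hev0 : ∀ᶠ t in 𝓝[>] (0 : ℝ), δ < scalarRisk t 0 := by
    have := continuous_scalarRisk_zero.tendsto 0
    rw [scalarRisk_zero_zero] at this
    exact (this.eventually (lt_mem_nhds hδ1)).filter_mono nhdsWithin_le_nhds
  obtain ⟨a, ha, ha0⟩ := (hev0.and eventually_mem_nhdsWithin).exists
  have ha0 : 0 < a := ha0
  have hdiv : Tendsto (fun t : ℝ => 1 / t ^ 2) atTop (𝓝 0) :=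
    tendsto_const_nhds.div_atTop (tendsto_pow_atTop two_ne_zero)
  obtain ⟨t₀, ht₀, hat₀⟩ :=
    ((hdiv.eventually (gt_mem_nhds hδ)).and (eventually_gt_atTop a)).exists
  have ht₀0 : 0 < t₀ := ha0.trans hat₀
  have hh₀ : 0 < h t₀ :=
    div_pos (sub_pos.2 ((scalarRisk_zero_lt_div_sq ht₀0).trans ht₀))
      (one_add_sq_sub_scalarRisk_pos ht₀0)
  -- The maximum may be sought on `[a, b]`: `h` is negative before `a`, and beyond `b` it is at most
  -- `δ / t ^ 2`, which is below `h t₀`.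
  obtain ⟨b, hb, htb⟩ :=
    ((hdiv.eventually (gt_mem_nhds (div_pos hh₀ hδ))).and (eventually_gt_atTop t₀)).exists
  have hcont : ContinuousOn h (Set.Icc a b) := fun t ht => by
    have := continuous_scalarRisk_zero
    exact ((by fun_prop : Continuous fun t => δ - scalarRisk t 0).continuousAt.div
      (by fun_prop : Continuous fun t => 1 + t ^ 2 - scalarRisk t 0).continuousAt
      (one_add_sq_sub_scalarRisk_pos (ha0.trans_le ht.1)).ne').continuousWithinAt
  obtain ⟨s, hs, hmax⟩ := isCompact_Icc.exists_isMaxOn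
    (Set.nonempty_Icc.2 (hat₀.trans htb).le) hcont
  have hs0 : 0 < s := ha0.trans_le hs.1
  have hst₀ : h t₀ ≤ h s := hmax ⟨hat₀.le, htb.le⟩
  have hle : ∀ t, 0 < t → h t ≤ h s := fun t ht => by
    rcases lt_or_ge t a with h1 | h1
    · refine (div_nonpos_of_nonpos_of_nonneg ?_ (one_add_sq_sub_scalarRisk_pos ht).le).trans
        (hh₀.le.trans hst₀)
      have := strictAnti_scalarRisk_zero h1
      simp only at this
      linarith
    rcases le_or_gt t b with h2 | h2
    · exact hmax ⟨h1, h2⟩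
    · refine le_trans ?_ hst₀
      have h3 : h t ≤ δ / t ^ 2 := by
        have h4 := scalarRisk_zero_le_one ht.le
        have h5 := scalarRisk_nonneg ht.le 0
        exact div_le_div₀ hδ.le (by linarith) (by positivity) (by linarith)
      have h6 : δ / t ^ 2 ≤ δ / b ^ 2 := by
        have : 0 < b := ht₀0.trans htb
        gcongr
      have h7 : δ / b ^ 2 ≤ h t₀ := by
        rw [lt_div_iff₀ hδ, one_div, inv_mul_eq_div] at hb
        exact hb.le
      exact h3.trans (h6.trans h7)
  have hsub : ∀ t, 0 < t → dtFun (h s) t - δ = (h s - h t) * (1 + t ^ 2 - scalarRisk t 0) :=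
    fun t ht => by
      rw [sub_mul, div_mul_cancel₀ _ (one_add_sq_sub_scalarRisk_pos ht).ne', dtFun_eq]
      ring
  have hge : ∀ t, 0 < t → δ ≤ dtFun (h s) t := fun t ht => by
    have := mul_nonneg (sub_nonneg.2 (hle t ht)) (one_add_sq_sub_scalarRisk_pos ht).le
    linarith [hsub t ht]
  have heq : dtFun (h s) s = δ := by
    have := hsub s hs0
    rw [sub_self, zero_mul] at this
    linarith
  have hs1 : h s < 1 := by
    rw [div_lt_one (one_add_sq_sub_scalarRisk_pos hs0)]
    nlinarith
  refine ⟨h s, hh₀.trans_le hst₀, s, ⟨hs0, heq⟩, fun t ⟨ht, hteq⟩ => ?_⟩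
  by_contra hne
  -- The root is unique by strict convexity of `dtFun (h s)`: between two roots the midpoint would
  -- lie below `δ`.
  have hmid := hge ((t + s) / 2) (by positivity)
  have hconv := convexOn_scalarRisk_zero.2 (Set.mem_univ t) (Set.mem_univ s)
    (by norm_num : (0 : ℝ) ≤ 1 / 2) (by norm_num : (0 : ℝ) ≤ 1 / 2) (by norm_num)
  simp only [smul_eq_mul] at hconv
  rw [show 1 / 2 * t + 1 / 2 * s = (t + s) / 2 by ring] at hconv
  rw [dtFun_eq] at hmid hteq heq
  have h1 := mul_le_mul_of_nonneg_left hconv (sub_pos.2 hs1).le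
  have h2 : 0 < h s * (t - s) ^ 2 :=
    mul_pos (hh₀.trans_le hst₀) (by have := sub_ne_zero.2 hne; positivity)
  nlinarith

/-- A value below `δ` would produce two roots, because `dtFun e` is at least `1 > δ` both at zero
and far out. As this holds for every transition point, it does not matter which one `epsStar`
selects. -/
lemma IsPhaseTransition.le_dtFun {δ e : ℝ} (hδ1 : δ < 1) (he : IsPhaseTransition δ e) {t : ℝ}
    (ht : 0 < t) : δ ≤ dtFun e t := by
  obtain ⟨he0, r, -, hr⟩ := he
  by_contra! hlt
  obtain ⟨x, hx, hxe⟩ := intermediate_value_Ioo' ht.le (continuous_dtFun e).continuousOn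
    (show δ ∈ Set.Ioo (dtFun e t) (dtFun e 0) from ⟨hlt, by rwa [dtFun_zero]⟩)
  -- Far enough that `e * b ≥ 1` and `b ≥ 1`, whence `e * b ^ 2 ≥ 1`.
  set b := t + 1 / e + 1 with hb
  have hinv : 0 < 1 / e := by positivity
  have hb1 : 1 ≤ dtFun e b := by
    have hb0 : 0 ≤ b := by positivity
    have h1 := scalarRisk_zero_le_one hb0
    have h2 := scalarRisk_nonneg hb0 0
    have h3 : 1 ≤ e * b := by
      rw [← div_le_iff₀' he0]; linarith
    have h4 : 1 ≤ e * b * b := by nlinarith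
    rw [dtFun_eq]
    nlinarith [mul_nonneg he0.le (sub_nonneg.2 h1)]
  obtain ⟨y, hy, hye⟩ := intermediate_value_Ioo (show t ≤ b by linarith)
    (continuous_dtFun e).continuousOn
    (show δ ∈ Set.Ioo (dtFun e t) (dtFun e b) from ⟨hlt, by linarith⟩)
  have h1 := hr x ⟨hx.1, hxe⟩
  have h2 := hr y ⟨ht.trans hy.1, hye⟩
  have := hx.2.trans hy.1
  linarith

/-- At and above the phase transition, `dtFun e` can only touch the level `δ` tangentially. -/
lemma eq_of_epsStar_le {δ e c : ℝ} (hδ : 0 < δ) (hδ1 : δ ≤ 1) (he1 : e ≤ 1) (he : epsStar δ ≤ e)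
    (hc : 0 < c) (h : dtFun e c = δ) : 2 * (1 - e) * Phi (-c) + e = δ := by
  have hpos := one_add_sq_sub_scalarRisk_pos hc
  rcases hδ1.eq_or_lt with h1 | h1
  · subst h1
    rw [epsStar, if_neg (lt_irrefl _)] at he
    have : e = 1 := le_antisymm he1 he
    subst this
    rw [sub_self]; ring
  · rw [epsStar, if_pos h1] at he
    have hpt : IsPhaseTransition δ (Classical.epsilon (IsPhaseTransition δ)) :=
      Classical.epsilon_spec (exists_isPhaseTransition hδ h1)
    -- `dtFun` is increasing in the sparsity, so the lower bound at the transition point carries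
    -- over to `e`.
    have hle : ∀ t, 0 < t → δ ≤ dtFun e t := fun t ht => by
      have h2 := dtFun_sub_dtFun (Classical.epsilon (IsPhaseTransition δ)) e t
      have h3 := mul_nonneg (sub_nonneg.2 he) (one_add_sq_sub_scalarRisk_pos ht).le
      have h4 := hpt.le_dtFun h1 ht
      linarith
    have hmin : IsLocalMin (dtFun e) c :=
      (lt_mem_nhds hc).mono fun t ht => h.trans_le (hle t ht)
    have hd := hmin.hasDerivAt_eq_zero (hasDerivAt_dtFun e c)
    rw [dtFun_eq, scalarRisk_zero_eq_sub, excess_zero_right] at h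
    linear_combination h - c / 2 * hd

end Lasso

/-! ### Reading off the boundary from the three cases -/

theorem mainTheorem3 (δ σ : ℝ) (hδ : 0 < δ) (hσ : 0 ≤ σ)
    (μ : Measure ℝ) [IsProbabilityMeasure μ]
    (hμ : Integrable (fun x : ℝ => x ^ 2) μ) (hε : 0 < Lasso.sparsity μ) :
    Tendsto (Lasso.tppInf δ σ μ) atTop (𝓝 0) ∧
    (1 < δ →
      ∃ L : ℝ × ℝ,
        Tendsto (fun lam => (Lasso.tppInf δ σ μ lam, Lasso.fdpInf δ σ μ lam)) (𝓝[>] 0) (𝓝 L) ∧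
        L.1 = 1) ∧
    (δ ≤ 1 → Lasso.epsStar δ ≤ Lasso.sparsity μ →
      ∃ L : ℝ × ℝ,
        Tendsto (fun lam => (Lasso.tppInf δ σ μ lam, Lasso.fdpInf δ σ μ lam)) (𝓝[>] 0) (𝓝 L) ∧
        L ∈ Lasso.boundaryLine (Lasso.sparsity μ) δ) ∧
    (δ ≤ 1 → Lasso.sparsity μ < Lasso.epsStar δ →
      ∃ L : ℝ × ℝ,
        Tendsto (fun lam => (Lasso.tppInf δ σ μ lam, Lasso.fdpInf δ σ μ lam)) (𝓝[>] 0) (𝓝 L) ∧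
        L ∈ Lasso.boundaryPolyline (Lasso.sparsity μ) δ) := by
  have hε1 := Lasso.sparsity_le_one (μ := μ)
  refine ⟨Lasso.tendsto_tppInf_atTop hδ hμ hε, ?_⟩
  obtain ⟨c, x, hlim, hcases⟩ := Lasso.exists_tendsto_proportions (σ := σ) hδ hμ hε
  set ε := Lasso.sparsity μ with hεdef
  have hline : ∀ {q x : ℝ}, q + ε * x = δ → (x, q / (q + ε * x)) ∈ Lasso.boundaryLine ε δ :=
    fun {q x} h => by
      show ε / δ * x + q / (q + ε * x) = 1
      rw [h]
      field_simp
      linarith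
  have hzero : ∀ {q : ℝ}, q = 1 - ε → q + ε * 1 = 1 := fun h => by rw [h]; ring
  have hPhi : 2 * (1 - ε) * Lasso.Phi (-0) = 1 - ε := by
    rw [neg_zero, Lasso.Phi_zero]; ring
  refine ⟨fun h1 => ⟨_, hlim, ?_⟩, fun h1 he => ⟨_, hlim, ?_⟩, fun h1 _ => ⟨_, hlim, ?_⟩⟩
  · rcases hcases with ⟨-, -, -, h⟩ | ⟨-, h, -⟩ | ⟨-, h, -⟩
    · exact absurd h h1.not_ge
    · exact h
    · exact h
  · rcases hcases with ⟨-, -, h, -⟩ | ⟨hc, rfl, h, -⟩ | ⟨rfl, rfl, h⟩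
    · exact hline h
    · exact hline (by rw [mul_one]; exact Lasso.eq_of_epsStar_le hδ h1 hε1 he hc h)
    -- Threshold zero requires `δ ≥ 1`, hence `δ = 1`, where the limit is the corner of the
    -- poly-line.
    · exact hline ((hzero hPhi).trans (le_antisymm h h1))
  · rcases hcases with ⟨h0, hx, h, -⟩ | ⟨-, rfl, -, h⟩ | ⟨rfl, rfl, h⟩
    · exact Or.inl ⟨hline h, h0, hx⟩
    · refine Or.inr ⟨rfl, ?_⟩
      have hq : 0 ≤ 2 * (1 - ε) * Lasso.Phi (-c) :=
        mul_nonneg (by linarith) (Lasso.Phi_nonneg _)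
      rw [mul_one]
      refine ⟨by positivity, ?_⟩
      have hp : 0 < 2 * (1 - ε) * Lasso.Phi (-c) + ε := by positivity
      -- The limiting false discovery proportion is `1 - ε / (2(1-ε)Φ(-c) + ε)`, and the denominator
      -- is at most `δ`.
      have h2 : ε / δ ≤ ε / (2 * (1 - ε) * Lasso.Phi (-c) + ε) := by gcongr
      have h3 : 2 * (1 - ε) * Lasso.Phi (-c) / (2 * (1 - ε) * Lasso.Phi (-c) + ε) =
          1 - ε / (2 * (1 - ε) * Lasso.Phi (-c) + ε) := by
        field_simp
        ring
      show _ / _ ≤ _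
      linarith
    · exact Or.inl ⟨hline ((hzero hPhi).trans (le_antisymm h h1)), zero_le_one, le_rfl⟩
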